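/- An instance of the 0--1 penalized knapsack problem (PKP) consists of $n$ items with non-negative integer weights $w_j$, profits $p_j$ and penalties $\pi_j$, and an integer capacity $c\ge 0$. A set $S$ of items is feasible if $\sum_{j\in S}w_j\le c$; its value is $\sum_{j\in S}p_j-\max_{j\in S}\pi_j$ (and $0$ for $S=\emptyset$); $z^*$ is the largest value of a feasible set. Let $p_{\min}=\min_j p_j$ and $\pi_{\max}=\max_j\pi_j$ (both $0$ if $n=0$). For $\delta>0$, the algorithm $A(\delta)$ does the following. Order the items by decreasing penalty. For every item $j$ with $w_j\le c$ (the leading item), compute a $(1-\delta)$-approximate solution $T_j$ of the ordinary knapsack problem with capacity $c-w_j$ whose items are those after $j$ in this order. Return a set of largest value among $\emptyset$ and the sets $\{j\}\cup T_j$. Let $\rho\in(1/2,1)$ be a constant. Then PKP restricted to the instances with $p_{\min}\ge\rho\,\pi_{\max}$ admits an FPTAS, namely $A(\delta)$ with $\delta=\varepsilon(2\rho-1)/\rho$. That is: (1) For every such instance and every $\varepsilon\in(0,1)$, every output of $A(\varepsilon(2\rho-1)/\rho)$, whichever $(1-\delta)$-approximate solutions $T_j$ are used, is a feasible set of value at least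 $(1-\varepsilon)z^*$. (2) There is a random access machine program (depending on $\rho$ only) which, given any such instance $I$ and any rational $\varepsilon\in(0,1)$, halts with an output of $A(\varepsilon(2\rho-1)/\rho)$, hence with a feasible set of value at least $(1-\varepsilon)z^*$, and whose running time under the logarithmic cost measure is bounded by a polynomial, depending on $\rho$ only, in the encoding length of $(I,\varepsilon)$ and $1/\varepsilon$. -/

import Mathlib

/-! ### The penalized knapsack problem -/

/-- An instance of the 0-1 penalized knapsack problem: `n` items, capacity `c`, and for every item a
weight, a profit and a penalty, all of them non-negative integers. -/
structure PKP where
  n : ℕ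
  c : ℕ
  w : Fin n → ℕ
  p : Fin n → ℕ
  pen : Fin n → ℕ

namespace PKP

variable (I : PKP)

def weight (S : Finset (Fin I.n)) : ℕ := ∑ j ∈ S, I.w j

def profit (S : Finset (Fin I.n)) : ℕ := ∑ j ∈ S, I.p j

def Feasible (S : Finset (Fin I.n)) : Prop := I.weight S ≤ I.c

instance : DecidablePred I.Feasible := fun S => inferInstanceAs (Decidable (I.weight S ≤ I.c))

/-- Total profit minus the greatest penalty of the selected items (the empty selection has value
`0`). -/
def value (S : Finset (Fin I.n)) : ℤ := (I.profit S : ℤ) - ((S.sup I.pen : ℕ) : ℤ)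

theorem feasible_nonempty : (Finset.univ.filter I.Feasible).Nonempty :=
  ⟨∅, by simp [Feasible, weight]⟩

/-- The optimal value `z*`. -/
def opt : ℤ := (Finset.univ.filter I.Feasible).sup' I.feasible_nonempty I.value

/-- The smallest profit (`0` if there are no items). -/
noncomputable def pMin : ℕ := ⨅ j, I.p j

/-- The largest penalty (`0` if there are no items). -/
def penMax : ℕ := Finset.univ.sup I.pen

/-- `S` is a feasible solution of value at least `(1 - ε) z*`. -/
def IsApprox (ε : ℝ) (S : Finset (Fin I.n)) : Prop :=
  I.Feasible S ∧ (1 - ε) * (I.opt : ℝ) ≤ (I.value S : ℝ)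

/-! ### The algorithm `A(δ)` -/

/-- Optimal value of the ordinary knapsack problem with item set `R` and capacity `cap`. -/
def kpOpt (R : Finset (Fin I.n)) (cap : ℕ) : ℕ :=
  (R.powerset.filter fun T => I.weight T ≤ cap).sup I.profit

/-- `T` is a `(1 - δ)`-approximate solution of the ordinary knapsack problem with item set `R` and
capacity `cap`. -/
def IsKPApprox (R : Finset (Fin I.n)) (cap : ℕ) (δ : ℝ) (T : Finset (Fin I.n)) : Prop :=
  T ⊆ R ∧ I.weight T ≤ cap ∧ (1 - δ) * (I.kpOpt R cap : ℝ) ≤ (I.profit T : ℝ)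

/-- The items that come after item `j` when the items are sorted by decreasing penalty, ties being
broken by the index. -/
def rest (j : Fin I.n) : Finset (Fin I.n) :=
  Finset.univ.filter fun i => I.pen i < I.pen j ∨ (I.pen i = I.pen j ∧ j < i)

/-- If the items are already numbered by decreasing penalty, `rest j` is `{j + 1, …, n}`. -/
theorem rest_eq_of_sorted (h : Antitone I.pen) (j : Fin I.n) : I.rest j = Finset.Ioi j := by
  ext i
  simp only [rest, Finset.mem_filter, Finset.mem_univ, true_and, Finset.mem_Ioi]
  constructor
  · rintro (h1 | h1)
    · by_contra h2
      exact absurd (h (not_lt.mp h2)) (not_le.mpr h1)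
    · exact h1.2
  · intro h1
    rcases (h h1.le).lt_or_eq with h2 | h2
    · exact Or.inl h2
    · exact Or.inr ⟨h2, h1⟩

/-- The candidates that `A(δ)` compares, if `T j` is the answer of the knapsack subroutine for the
leading item `j`: the empty set, and `{j} ∪ T j` for every item `j` that fits into the knapsack. -/
def candidates (T : Fin I.n → Finset (Fin I.n)) : Finset (Finset (Fin I.n)) :=
  insert ∅ ((Finset.univ.filter fun j => I.w j ≤ I.c).image fun j => insert j (T j))

/-- `S` is a possible output of `A(δ)`: for every leading item `j` that fits, the remaining knapsack
problem (capacity `c - w j`, items after `j`) is answered by some `(1 - δ)`-approximate solution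
`T j`, and `S` is a candidate of largest value. -/
def IsOutputA (δ : ℝ) (S : Finset (Fin I.n)) : Prop :=
  ∃ T : Fin I.n → Finset (Fin I.n),
    (∀ j, I.w j ≤ I.c → I.IsKPApprox (I.rest j) (I.c - I.w j) δ (T j)) ∧
    S ∈ I.candidates T ∧ ∀ S' ∈ I.candidates T, I.value S' ≤ I.value S

/-- Encoding length: the number of binary digits of all the numbers of the instance, plus one for
each number. -/
def size : ℕ :=
  (Nat.size I.n + 1) + (Nat.size I.c + 1) +
    ∑ j, ((Nat.size (I.w j) + 1) + (Nat.size (I.p j) + 1) + (Nat.size (I.pen j) + 1))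

end PKP

/-! ### Random access machine programs with logarithmic cost

Programs work on registers and arrays that hold natural numbers of any size. An operation is charged
the number of binary digits of the numbers that it handles, addresses included. -/

namespace RAM

structure State where
  reg : ℕ → ℕ
  arr : ℕ → ℕ → ℕ

namespace State

def setReg (s : State) (x v : ℕ) : State :=
  { s with reg := Function.update s.reg x v }

def setArr (s : State) (a i v : ℕ) : State :=
  { s with arr := Function.update s.arr a (Function.update (s.arr a) i v) }

end State

/-- Expressions: constants, registers, array entries `a[i]`, and arithmetic on `ℕ` (truncated
subtraction, integer division with `x / 0 = 0`). -/
inductive Exp where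
  | const (k : ℕ)
  | reg (x : ℕ)
  | get (a : ℕ) (i : Exp)
  | plus (e f : Exp)
  | minus (e f : Exp)
  | times (e f : Exp)
  | quot (e f : Exp)

namespace Exp

def eval (s : State) : Exp → ℕ
  | const k => k
  | reg x => s.reg x
  | get a i => s.arr a (i.eval s)
  | plus e f => e.eval s + f.eval s
  | minus e f => e.eval s - f.eval s
  | times e f => e.eval s * f.eval s
  | quot e f => e.eval s / f.eval s

/-- Every node of the expression costs `1` plus the number of binary digits of its value. -/
def cost (s : State) : Exp → ℕ
  | const k => Nat.size k + 1
  | reg x => Nat.size (s.reg x) + 1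
  | get a i => i.cost s + Nat.size (s.arr a (i.eval s)) + 1
  | plus e f => e.cost s + f.cost s + Nat.size (e.eval s + f.eval s) + 1
  | minus e f => e.cost s + f.cost s + Nat.size (e.eval s - f.eval s) + 1
  | times e f => e.cost s + f.cost s + Nat.size (e.eval s * f.eval s) + 1
  | quot e f => e.cost s + f.cost s + Nat.size (e.eval s / f.eval s) + 1

end Exp

inductive Prog where
  | skip
  | assign (x : ℕ) (e : Exp)
  | store (a : ℕ) (i e : Exp)
  | seq (P Q : Prog)
  | ite (e : Exp) (P Q : Prog)
  | loop (e : Exp) (P : Prog)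

/-- `Exec P s s' t`: started in the state `s`, the program `P` halts in the state `s'`, and the run
has total cost `t`. Conditions are true when they are non-zero, and `loop e P` repeats `P` while `e`
is true. -/
inductive Exec : Prog → State → State → ℕ → Prop where
  | skip (s : State) : Exec .skip s s 1
  | assign (x : ℕ) (e : Exp) (s : State) :
      Exec (.assign x e) s (s.setReg x (e.eval s)) (e.cost s + 1)
  | store (a : ℕ) (i e : Exp) (s : State) :
      Exec (.store a i e) s (s.setArr a (i.eval s) (e.eval s)) (i.cost s + e.cost s + 1)
  | seq {P Q : Prog} {s s₁ s₂ : State} {t₁ t₂ : ℕ} :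
      Exec P s s₁ t₁ → Exec Q s₁ s₂ t₂ → Exec (.seq P Q) s s₂ (t₁ + t₂)
  | iteTrue {e : Exp} {P Q : Prog} {s s₁ : State} {t : ℕ} :
      e.eval s ≠ 0 → Exec P s s₁ t → Exec (.ite e P Q) s s₁ (e.cost s + t + 1)
  | iteFalse {e : Exp} {P Q : Prog} {s s₁ : State} {t : ℕ} :
      e.eval s = 0 → Exec Q s s₁ t → Exec (.ite e P Q) s s₁ (e.cost s + t + 1)
  | loopTrue {e : Exp} {P : Prog} {s s₁ s₂ : State} {t₁ t₂ : ℕ} :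
      e.eval s ≠ 0 → Exec P s s₁ t₁ → Exec (.loop e P) s₁ s₂ t₂ →
      Exec (.loop e P) s s₂ (e.cost s + t₁ + t₂ + 1)
  | loopFalse {e : Exp} {P : Prog} {s : State} :
      e.eval s = 0 → Exec (.loop e P) s s (e.cost s + 1)

/-- Programs are deterministic: the final state and the cost are determined by the initial state. -/
theorem Exec.det {P : Prog} {s s₁ s₂ : State} {t₁ t₂ : ℕ} (h₁ : Exec P s s₁ t₁)
    (h₂ : Exec P s s₂ t₂) : s₁ = s₂ ∧ t₁ = t₂ := by
  induction h₁ generalizing s₂ t₂ with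
  | skip s => cases h₂; exact ⟨rfl, rfl⟩
  | assign x e s => cases h₂; exact ⟨rfl, rfl⟩
  | store a i e s => cases h₂; exact ⟨rfl, rfl⟩
  | seq _ _ ih1 ih2 =>
    cases h₂ with
    | seq g1 g2 =>
      obtain ⟨rfl, rfl⟩ := ih1 g1
      obtain ⟨rfl, rfl⟩ := ih2 g2
      exact ⟨rfl, rfl⟩
  | iteTrue h _ ih =>
    cases h₂ with
    | iteTrue _ g =>
      obtain ⟨rfl, rfl⟩ := ih g
      exact ⟨rfl, rfl⟩
    | iteFalse g _ => exact absurd g h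
  | iteFalse h _ ih =>
    cases h₂ with
    | iteTrue g _ => exact absurd h g
    | iteFalse _ g =>
      obtain ⟨rfl, rfl⟩ := ih g
      exact ⟨rfl, rfl⟩
  | loopTrue h _ _ ih1 ih2 =>
    cases h₂ with
    | loopTrue _ g1 g2 =>
      obtain ⟨rfl, rfl⟩ := ih1 g1
      obtain ⟨rfl, rfl⟩ := ih2 g2
      exact ⟨rfl, rfl⟩
    | loopFalse g => exact absurd g h
  | loopFalse h =>
    cases h₂ with
    | loopTrue g _ _ => exact absurd h g
    | loopFalse _ => exact ⟨rfl, rfl⟩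

end RAM

/-! ### Approximation schemes -/

namespace PKP

/-- The input `(I, ε)` in memory: `n`, `c`, and the numerator and the denominator of `ε` in the
registers 0 to 3, the profits, weights and penalties in the arrays 0, 1, 2, and zero elsewhere. -/
def input (I : PKP) (ε : ℚ) : RAM.State where
  reg := fun x =>
    if x = 0 then I.n else if x = 1 then I.c else if x = 2 then ε.num.toNat
    else if x = 3 then ε.den else 0
  arr := fun a i =>
    if h : i < I.n then
      if a = 0 then I.p ⟨i, h⟩ else if a = 1 then I.w ⟨i, h⟩ else if a = 2 then I.pen ⟨i, h⟩ else 0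
    else 0

/-- On the input `(I, ε)`, the program halts with total cost `t`, and the first `n` entries of
array 3 are then the characteristic vector of `S`. -/
def Outputs (P : RAM.Prog) (I : PKP) (ε : ℚ) (S : Finset (Fin I.n)) (t : ℕ) : Prop :=
  ∃ s : RAM.State, RAM.Exec P (I.input ε) s t ∧
    ∀ j : Fin I.n, s.arr 3 j = if j ∈ S then 1 else 0

/-- The program `P` is a fully polynomial time approximation scheme for the instances of the
penalized knapsack problem in the class `C`: for every instance `I` in `C` and every rational
`0 < ε < 1`, it halts on `(I, ε)` with a feasible solution of value at least `(1 - ε) z*`, in time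
polynomial in the encoding length of `(I, ε)` and in `1 / ε`. -/
def IsFPTAS (P : RAM.Prog) (C : PKP → Prop) : Prop :=
  ∃ a k : ℕ, ∀ I : PKP, C I → ∀ ε : ℚ, 0 < ε → ε < 1 →
    ∃ (S : Finset (Fin I.n)) (t : ℕ), Outputs P I ε S t ∧ I.IsApprox (ε : ℝ) S ∧
      (t : ℝ) ≤
        a * (((I.size + Nat.size ε.num.toNat + Nat.size ε.den : ℕ) : ℝ) + 1 / (ε : ℝ)) ^ k

end PKP

/-! Approximation. Let `O` be an optimal set, `j` its first item in the order, and `Q` the profit of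
`O \ {j}`. The set `O \ {j}` competes in the knapsack problem solved for `j`, and no item after `j`
has a larger penalty than `j`. So the candidate `{j} ∪ T j` has value at least `p j + (1 - δ) Q -
pen j = z* - δ Q`, and it remains to see that `δ Q ≤ ε z*`, that is, `(2ρ - 1) Q ≤ ρ z*`. This is
clear if `O = {j}`. Otherwise `Q` and `p j` are both at least `pMin`, hence `ρ p j + (1 - ρ) Q ≥
pMin ≥ ρ penMax ≥ ρ pen j`, which rearranges to the claim (`IsOutputA.isApprox`).

Program. Fix a natural number `K > ρ / (2ρ - 1)`. Then `ε / K ≤ δ`, so the program can work with the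
rational precision `ε / K` and never handles `ρ`. For a leading item `j`, let `P` be the largest
profit of a later item that fits together with `j`. Profits are rounded down to multiples of `ε P /
(K n)`. A set loses at most `n` such units, that is `(ε / K) P`, and `P` is at most the knapsack
optimum because a single item attains it (`exists_isKPApprox`). The rounded problem is solved by
dynamic programming over the rounded profit. Each table entry is one number, the weight of a set
followed by its characteristic vector as `n` binary digits. A smallest code has smallest weight,
adding an item adds its code, and the set is read off the digits without backtracking
(`exists_code_eq_table`, `table_le_code`, `code_lt_codeBound_iff`). `result_spec` shows that the
best set found is a best candidate.

Cost. The runs of the subprograms are described by the recursive functions `maxProfit`, `table`,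
`best`, `codeProfit` and `result`, so their correctness is proved without reference to memory. For
fixed `K`, all stored numbers have linearly many digits (`inputBounded`). Each elementary step is
then charged a common linear bound, and only steps have to be counted (`prog_runs`, `cost_le`). -/

namespace RAM

/-! ### Cost accounting for programs -/

/-- The size of an expression, where constants are counted in unary. -/
def Exp.nodes : Exp → ℕ
  | .const k => k + 1
  | .reg _ => 1
  | .get _ i => i.nodes + 1
  | .plus e f => e.nodes + f.nodes + 1
  | .minus e f => e.nodes + f.nodes + 1
  | .times e f => e.nodes + f.nodes + 1
  | .quot e f => e.nodes + f.nodes + 1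

/-- All the numbers in memory are at most `2 ^ B`. -/
def State.Bounded (s : State) (B : ℕ) : Prop :=
  (∀ x, s.reg x ≤ 2 ^ B) ∧ ∀ a i, s.arr a i ≤ 2 ^ B

theorem State.Bounded.setReg {s : State} {B : ℕ} (h : s.Bounded B) (x : ℕ) {v : ℕ}
    (hv : v ≤ 2 ^ B) : (s.setReg x v).Bounded B := by
  refine ⟨fun y => ?_, h.2⟩
  simp only [State.setReg, Function.update_apply]
  split_ifs
  · exact hv
  · exact h.1 y

theorem State.setReg_setReg (s : State) (x v v' : ℕ) :
    (s.setReg x v).setReg x v' = s.setReg x v' := by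
  simp [State.setReg]

theorem State.setReg_of_eq {s : State} {x v : ℕ} (h : s.reg x = v) : s.setReg x v = s := by
  subst h
  simp [State.setReg]

theorem State.reg_setReg (s : State) (x v : ℕ) : (s.setReg x v).reg x = v := by
  simp [State.setReg]

/-- Sums and products at most add the exponents of their operands, up to a factor `2 ≤ 2 ^ B` that
the extra node pays for. Unary counting of constants covers the leaves through `k ≤ 2 ^ k`. -/
theorem Exp.eval_le {s : State} {B : ℕ} (hB : 1 ≤ B) (h : s.Bounded B) (e : Exp) :
    e.eval s ≤ 2 ^ (B * e.nodes) := by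
  have key : ∀ a b : ℕ, ∀ x y : ℕ, x ≤ 2 ^ (B * a) → y ≤ 2 ^ (B * b) →
      x + y ≤ 2 ^ (B * (a + b + 1)) ∧ x * y ≤ 2 ^ (B * (a + b + 1)) := by
    intro a b x y hx hy
    have ha : 1 ≤ 2 ^ (B * a) := Nat.one_le_two_pow
    have hb : 1 ≤ 2 ^ (B * b) := Nat.one_le_two_pow
    have e1 : 2 ^ (B * (a + b + 1)) = 2 ^ (B * a) * 2 ^ (B * b) * 2 ^ B := by
      rw [← pow_add, ← pow_add]; congr 1; ring
    have h2 : 2 ≤ 2 ^ B := by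
      calc 2 = 2 ^ 1 := rfl
        _ ≤ 2 ^ B := Nat.pow_le_pow_right (by norm_num) hB
    have e2 : 2 ^ (B * a) * 2 ^ (B * b) * 2 ≤ 2 ^ (B * (a + b + 1)) := by
      rw [e1]; exact Nat.mul_le_mul_left _ h2
    constructor
    · nlinarith
    · have := Nat.mul_le_mul hx hy
      omega
  induction e with
  | const k =>
    calc k ≤ 2 ^ k := Nat.lt_two_pow_self.le
      _ ≤ 2 ^ (B * (k + 1)) := Nat.pow_le_pow_right (by norm_num) (by nlinarith)
  | reg x => simpa [nodes, eval] using h.1 x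
  | get a i ih =>
    calc s.arr a (i.eval s) ≤ 2 ^ B := h.2 _ _
      _ ≤ 2 ^ (B * (i.nodes + 1)) := Nat.pow_le_pow_right (by norm_num) (by nlinarith)
  | plus e f he hf => exact (key _ _ _ _ he hf).1
  | minus e f he hf => exact (Nat.sub_le _ _).trans ((Nat.le_add_right _ _).trans (key _ _ _ _ he hf).1)
  | times e f he hf => exact (key _ _ _ _ he hf).2
  | quot e f he hf =>
    exact (Nat.div_le_self _ _).trans ((Nat.le_add_right _ _).trans (key _ _ _ _ he hf).1)

theorem size_le_of_le_two_pow {x a : ℕ} (h : x ≤ 2 ^ a) : Nat.size x ≤ a + 1 :=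
  Nat.size_le.2 (h.trans_lt (Nat.pow_lt_pow_right (by norm_num) (Nat.lt_succ_self a)))

/-- By `eval_le` every node has a value of at most `B * e.nodes + 1` digits, and there are at most
`e.nodes` nodes to charge. -/
theorem Exp.cost_le {s : State} {B : ℕ} (hB : 1 ≤ B) (h : s.Bounded B) (e : Exp) :
    e.cost s ≤ e.nodes * (B * e.nodes + 2) := by
  have key : ∀ a b x y z : ℕ, x ≤ a * (B * a + 2) → y ≤ b * (B * b + 2) →
      z ≤ B * (a + b + 1) + 1 → x + y + z + 1 ≤ (a + b + 1) * (B * (a + b + 1) + 2) := by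
    intro a b x y z hx hy hz
    have : 0 ≤ a * B * b ∧ 0 ≤ a * B ∧ 0 ≤ B * b := by simp
    nlinarith
  have hs := fun e : Exp => size_le_of_le_two_pow (e.eval_le hB h)
  induction e with
  | const k =>
    have h1 : Nat.size k ≤ k + 1 := size_le_of_le_two_pow Nat.lt_two_pow_self.le
    have h2 : (k + 1) * 2 ≤ (k + 1) * (B * (k + 1) + 2) := Nat.mul_le_mul_left _ (by omega)
    simp only [cost, nodes]
    omega
  | reg x =>
    have := size_le_of_le_two_pow (h.1 x)
    simp only [cost, nodes]
    omega
  | get a i ih =>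
    have := size_le_of_le_two_pow (h.2 a (i.eval s))
    simp only [cost, nodes]
    nlinarith [Nat.zero_le (B * i.nodes)]
  | plus e f he hf => exact key _ _ _ _ _ he hf (hs (.plus e f))
  | minus e f he hf => exact key _ _ _ _ _ he hf (hs (.minus e f))
  | times e f he hf => exact key _ _ _ _ _ he hf (hs (.times e f))
  | quot e f he hf => exact key _ _ _ _ _ he hf (hs (.quot e f))

/-- A bound on the cost of an elementary step whose expressions have at most `m` nodes, in a memory
that is bounded by `2 ^ B`. -/
def unit (m B : ℕ) : ℕ := m * (B * m + 2) + 1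

theorem Exp.cost_lt_unit {s : State} {m B : ℕ} (hB : 1 ≤ B) (h : s.Bounded B) {e : Exp}
    (he : e.nodes ≤ m) : e.cost s + 1 ≤ unit m B := by
  have := e.cost_le hB h
  have : e.nodes * (B * e.nodes + 2) ≤ m * (B * m + 2) := by gcongr
  unfold unit
  omega

/-- The program `P` leads from `s` to `s'` at a cost of at most `N` elementary steps. -/
def Runs (m B : ℕ) (P : Prog) (s s' : State) (N : ℕ) : Prop :=
  ∃ t, Exec P s s' t ∧ t ≤ N * unit m B

namespace Runs

variable {m B : ℕ} {P Q : Prog} {s s₁ s₂ : State} {N N₁ N₂ : ℕ}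

theorem mono (h : Runs m B P s s₁ N₁) (hN : N₁ ≤ N₂) : Runs m B P s s₁ N₂ := by
  obtain ⟨t, h1, h2⟩ := h
  exact ⟨t, h1, h2.trans (Nat.mul_le_mul_right _ hN)⟩

theorem skip : Runs m B .skip s s 1 :=
  ⟨1, .skip s, by simp [unit]⟩

theorem assign (hB : 1 ≤ B) (h : s.Bounded B) {x : ℕ} {e : Exp} (he : e.nodes ≤ m)
    (hs : s.setReg x (e.eval s) = s₁) : Runs m B (.assign x e) s s₁ 1 := by
  subst hs
  exact ⟨_, .assign x e s, by simpa using e.cost_lt_unit hB h he⟩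

theorem store (hB : 1 ≤ B) (h : s.Bounded B) {a : ℕ} {i e : Exp} (he : i.nodes + e.nodes ≤ m)
    (hs : s.setArr a (i.eval s) (e.eval s) = s₁) : Runs m B (.store a i e) s s₁ 1 := by
  subst hs
  refine ⟨_, .store a i e s, ?_⟩
  have h1 := i.cost_le hB h
  have h2 := e.cost_le hB h
  have h3 : (i.nodes + e.nodes) * (B * (i.nodes + e.nodes) + 2) ≤ m * (B * m + 2) := by gcongr
  have h4 : i.nodes * (B * i.nodes + 2) + e.nodes * (B * e.nodes + 2) ≤
      (i.nodes + e.nodes) * (B * (i.nodes + e.nodes) + 2) := by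
    nlinarith [Nat.zero_le (B * i.nodes * e.nodes)]
  unfold unit
  omega

theorem seq (h₁ : Runs m B P s s₁ N₁) (h₂ : Runs m B Q s₁ s₂ N₂) :
    Runs m B (.seq P Q) s s₂ (N₁ + N₂) := by
  obtain ⟨t₁, h1, h1'⟩ := h₁
  obtain ⟨t₂, h2, h2'⟩ := h₂
  exact ⟨_, .seq h1 h2, by rw [add_mul]; exact Nat.add_le_add h1' h2'⟩

theorem ite (hB : 1 ≤ B) (h : s.Bounded B) {e : Exp} (he : e.nodes ≤ m)
    (h₁ : e.eval s ≠ 0 → Runs m B P s s₁ N) (h₂ : e.eval s = 0 → Runs m B Q s s₁ N) :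
    Runs m B (.ite e P Q) s s₁ (N + 1) := by
  have hc := e.cost_lt_unit hB h he
  by_cases h0 : e.eval s = 0
  · obtain ⟨t, ht, ht'⟩ := h₂ h0
    exact ⟨_, .iteFalse h0 ht, by rw [add_mul]; omega⟩
  · obtain ⟨t, ht, ht'⟩ := h₁ h0
    exact ⟨_, .iteTrue h0 ht, by rw [add_mul]; omega⟩

theorem loopFalse (hB : 1 ≤ B) (h : s.Bounded B) {e : Exp} (he : e.nodes ≤ m)
    (h0 : e.eval s = 0) : Runs m B (.loop e P) s s 1 :=
  ⟨_, .loopFalse h0, by simpa using e.cost_lt_unit hB h he⟩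

theorem loopTrue (hB : 1 ≤ B) (h : s.Bounded B) {e : Exp} (he : e.nodes ≤ m)
    (h0 : e.eval s ≠ 0) (h₁ : Runs m B P s s₁ N₁) (h₂ : Runs m B (.loop e P) s₁ s₂ N₂) :
    Runs m B (.loop e P) s s₂ (N₁ + 1 + N₂) := by
  have hc := e.cost_lt_unit hB h he
  obtain ⟨t₁, h1, h1'⟩ := h₁
  obtain ⟨t₂, h2, h2'⟩ := h₂
  refine ⟨_, .loopTrue h0 h1 h2, ?_⟩
  rw [add_mul, add_mul]
  omega

end Runs

/-! ### Counting loops -/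

/-- `for x = 0, …, e - 1 do P`, for a register `x` that is `0` at the beginning; it is `0` again at
the end. -/
def Prog.up (x : ℕ) (e : Exp) (P : Prog) : Prog :=
  .seq (.loop (.minus e (.reg x)) (.seq P (.assign x (.plus (.reg x) (.const 1)))))
    (.assign x (.const 0))

/-- `for x = e - 1, …, 0 do P`. -/
def Prog.down (x : ℕ) (e : Exp) (P : Prog) : Prog :=
  .seq (.assign x e) (.loop (.reg x) (.seq (.assign x (.minus (.reg x) (.const 1))) P))

namespace Runs

variable {m B : ℕ} {P : Prog} {s : State} {N : ℕ}

/-- Ascending loops, with an invariant. -/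
theorem up_of_invariant (hB : 1 ≤ B) (hm : 4 ≤ m) {x n : ℕ} {e : Exp} (he : e.nodes + 2 ≤ m)
    (Inv : ℕ → State → Prop)
    (hInv : ∀ k ≤ n, ∀ s, Inv k s → s.reg x = k ∧ e.eval s = n ∧ s.Bounded B)
    (body : ∀ k < n, ∀ s, Inv k s → ∃ s', Inv (k + 1) s' ∧ Runs m B P s (s'.setReg x k) N)
    (h0 : Inv 0 s) :
    ∃ s', Inv n s' ∧ Runs m B (.up x e P) s (s'.setReg x 0) (n * (N + 2) + 2) := by
  have main : ∀ d k, k + d = n → ∀ s, Inv k s → ∃ s', Inv n s' ∧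
      Runs m B (.loop (.minus e (.reg x)) (.seq P (.assign x (.plus (.reg x) (.const 1)))))
        s s' (d * (N + 2) + 1) := by
    intro d
    induction d with
    | zero =>
      intro k hk s hs
      obtain rfl : k = n := by omega
      obtain ⟨h1, h2, h3⟩ := hInv k le_rfl s hs
      refine ⟨s, hs, (loopFalse hB h3 (by simp only [Exp.nodes]; omega) ?_).mono (by omega)⟩
      simp [Exp.eval, h1, h2]
    | succ d ih =>
      intro k hk s hs
      obtain ⟨h1, h2, h3⟩ := hInv k (by omega) s hs
      obtain ⟨s₁, hs₁, hr⟩ := body k (by omega) s hs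
      obtain ⟨h1', h2', h3'⟩ := hInv (k + 1) (by omega) s₁ hs₁
      obtain ⟨s₂, hs₂, hr₂⟩ := ih (k + 1) (by omega) s₁ hs₁
      refine ⟨s₂, hs₂, ?_⟩
      have hk' : k ≤ 2 ^ B := h1 ▸ h3.1 x
      -- The body leaves the counter at `k`, so it ends in `s₁` with register `x` set back to `k`.
      -- Since `s₁` itself has `k + 1` there, the increment lands exactly on `s₁`.
      have hinc : Runs m B (.assign x (.plus (.reg x) (.const 1))) (s₁.setReg x k) s₁ 1 := by
        refine assign hB (h3'.setReg x hk') (by simpa [Exp.nodes] using hm) ?_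
        simp only [Exp.eval, State.reg_setReg, State.setReg_setReg]
        exact State.setReg_of_eq h1'
      refine (loopTrue hB h3 (by simp only [Exp.nodes]; omega) ?_ (hr.seq hinc) hr₂).mono ?_
      · simp only [Exp.eval, h1, h2]
        omega
      · rw [add_mul]
        omega
  obtain ⟨s', hs', hr⟩ := main n 0 (by omega) s h0
  refine ⟨s', hs', (hr.seq (assign hB (hInv n le_rfl s' hs').2.2 ?_ rfl)).mono (by omega)⟩
  simp only [Exp.nodes]
  omega

/-- Ascending loops, with an explicit sequence of states. -/
theorem up (hB : 1 ≤ B) (hm : 4 ≤ m) {x n : ℕ} {e : Exp} (he : e.nodes + 2 ≤ m)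
    (st : ℕ → State)
    (hx : ∀ k ≤ n, (st k).reg x = k) (hn : ∀ k ≤ n, e.eval (st k) = n)
    (hb : ∀ k ≤ n, (st k).Bounded B)
    (body : ∀ k < n, Runs m B P (st k) ((st (k + 1)).setReg x k) N) :
    Runs m B (.up x e P) (st 0) ((st n).setReg x 0) (n * (N + 2) + 2) := by
  obtain ⟨s', rfl, h⟩ := up_of_invariant (s := st 0) (P := P) (N := N) hB hm he
    (fun k s => s = st k)
    (by rintro k hk s rfl; exact ⟨hx k hk, hn k hk, hb k hk⟩)
    (by rintro k hk s rfl; exact ⟨_, rfl, body k hk⟩) rfl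
  exact h

/-- Descending loops, with an explicit sequence of states. -/
theorem down (hB : 1 ≤ B) (hm : 4 ≤ m) {x n : ℕ} {e : Exp} (he : e.nodes ≤ m)
    (hs : s.Bounded B) (st : ℕ → State) (h0 : s.setReg x (e.eval s) = st n)
    (hx : ∀ k ≤ n, (st k).reg x = k) (hb : ∀ k ≤ n, (st k).Bounded B)
    (body : ∀ k < n, Runs m B P ((st (k + 1)).setReg x k) (st k) N) :
    Runs m B (.down x e P) s (st 0) (n * (N + 2) + 2) := by
  have main : ∀ k ≤ n,
      Runs m B (.loop (.reg x) (.seq (.assign x (.minus (.reg x) (.const 1))) P))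
        (st k) (st 0) (k * (N + 2) + 1) := by
    intro k
    induction k with
    | zero =>
      intro hk
      refine (loopFalse hB (hb 0 hk) ?_ (by simpa only [Exp.eval] using hx 0 hk)).mono (by omega)
      simp only [Exp.nodes]
      omega
    | succ k ih =>
      intro hk
      have hdec : Runs m B (.assign x (.minus (.reg x) (.const 1))) (st (k + 1))
          ((st (k + 1)).setReg x k) 1 := by
        refine assign hB (hb _ hk) (by simp only [Exp.nodes]; omega) ?_
        simp only [Exp.eval, hx _ hk, Nat.add_sub_cancel]
      refine (loopTrue hB (hb _ hk) (by simp only [Exp.nodes]; omega) ?_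
        (hdec.seq (body k (by omega))) (ih (Nat.le_of_succ_le hk))).mono ?_
      · simp [Exp.eval, hx _ hk]
      · rw [add_mul]
        omega
  exact ((assign hB hs he h0).seq (main n le_rfl)).mono (by omega)

end Runs

end RAM

open RAM

/-! ### Arithmetic of the program -/

namespace PKP

variable (I : PKP)

/-- The profit of item `i`, extended by `0`; similarly for the weights and the penalties. -/
def profitAt (i : ℕ) : ℕ := if h : i < I.n then I.p ⟨i, h⟩ else 0

def weightAt (i : ℕ) : ℕ := if h : i < I.n then I.w ⟨i, h⟩ else 0

def penAt (i : ℕ) : ℕ := if h : i < I.n then I.pen ⟨i, h⟩ else 0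

/-- Non-zero if and only if item `i` comes after item `j` and fits into the knapsack with it. -/
def eligible (j i : ℕ) : ℕ :=
  (I.penAt j * I.n + i - (I.penAt i * I.n + j)) * (I.c - I.weightAt j + 1 - I.weightAt i)

/-- The largest profit of an item among the first `k` ones that is eligible for the leading
item `j`. -/
def maxProfit (j : ℕ) : ℕ → ℕ
  | 0 => 0
  | k + 1 =>
    if I.eligible j k = 0 then maxProfit j k
    else maxProfit j k + (I.profitAt k - maxProfit j k)

/-- The weight of an item, followed by `n` binary digits that identify it. -/
def itemCode (i : ℕ) : ℕ := I.weightAt i * 2 ^ I.n + 2 ^ i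

/-- The codes of the sets of items that fit into the knapsack with `j` are smaller than this. -/
def codeBound (j : ℕ) : ℕ := (I.c - I.weightAt j + 1) * 2 ^ I.n

variable (K num den : ℕ)

/-- The scaled profit of an item. -/
def scaled (j i : ℕ) : ℕ :=
  I.profitAt i * (K * I.n * den) / (I.maxProfit j I.n * num)

/-- A bound on the scaled profit of a set of items. -/
def scaledBound : ℕ := I.n * (K * I.n * den / num)

/-- The dynamic programming table: `table j k v` is the smallest code of a set of eligible items
among the first `k` ones of scaled profit at least `v` (or `codeBound j`). -/
def table (j : ℕ) : ℕ → ℕ → ℕ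
  | 0, v => if v = 0 then 0 else I.codeBound j
  | k + 1, v =>
    if I.eligible j k = 0 then table j k v
    else min (table j k v) (table j k (v - I.scaled K num den j k) + I.itemCode k)

/-- The entry of the table for the largest scaled profit below `k` that can be achieved. -/
def best (j : ℕ) : ℕ → ℕ
  | 0 => 0
  | k + 1 =>
    if I.codeBound j - I.table K num den j I.n k = 0 then best j k
    else I.table K num den j I.n k

end PKP

/-- The binary digit of `x` at position `i`. -/
def binaryDigit (x i : ℕ) : ℕ := x / 2 ^ i - 2 * (x / 2 ^ i / 2)

/-- The profit of the set of items `i < k` that is encoded by the last binary digits of `x`. -/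
def PKP.codeProfit (I : PKP) (x : ℕ) : ℕ → ℕ
  | 0 => 0
  | k + 1 => I.codeProfit x k + I.profitAt k * binaryDigit x k

/-- The value and the code of the best set that is found for the leading items `j < k`. -/
def PKP.result (I : PKP) (K num den : ℕ) : ℕ → ℕ × ℕ
  | 0 => (0, 0)
  | k + 1 =>
    if I.c + 1 - I.weightAt k = 0 then I.result K num den k
    else
      let x := I.best K num den k (I.scaledBound K num den + 1)
      if I.profitAt k + I.codeProfit x I.n - (I.penAt k + (I.result K num den k).1) = 0 then
        I.result K num den k
      else (I.profitAt k + I.codeProfit x I.n - I.penAt k, x + 2 ^ k)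

/-! ### The program -/

namespace KnapsackProgram

/-- The registers and arrays that are modified by the program. -/
structure Vars where
  j : ℕ
  i : ℕ
  v : ℕ
  pm : ℕ
  x : ℕ
  prof : ℕ
  bestVal : ℕ
  bestCode : ℕ
  bound : ℕ
  out : ℕ → ℕ
  tab : ℕ → ℕ
  pow : ℕ → ℕ

variable (I : PKP) (K num den : ℕ)

/-- The memory with the instance `I`, the precision `num / den` and the variables `m`. -/
def Vars.st (m : Vars) : State where
  reg := fun
    | 0 => I.n
    | 1 => I.c
    | 2 => num
    | 3 => den
    | 4 => m.j
    | 5 => m.i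
    | 6 => m.v
    | 7 => m.pm
    | 8 => m.x
    | 9 => m.prof
    | 10 => m.bestVal
    | 11 => m.bestCode
    | 12 => m.bound
    | _ => 0
  arr := fun
    | 0 => I.profitAt
    | 1 => I.weightAt
    | 2 => I.penAt
    | 3 => m.out
    | 4 => m.tab
    | 5 => m.pow
    | _ => fun _ => 0

structure Vars.Bounded (B : ℕ) (m : Vars) : Prop where
  j : m.j ≤ 2 ^ B
  i : m.i ≤ 2 ^ B
  v : m.v ≤ 2 ^ B
  pm : m.pm ≤ 2 ^ B
  x : m.x ≤ 2 ^ B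
  prof : m.prof ≤ 2 ^ B
  bestVal : m.bestVal ≤ 2 ^ B
  bestCode : m.bestCode ≤ 2 ^ B
  bound : m.bound ≤ 2 ^ B
  out : ∀ k, m.out k ≤ 2 ^ B
  tab : ∀ k, m.tab k ≤ 2 ^ B
  pow : ∀ k, m.pow k ≤ 2 ^ B

/-- The numbers of the input and those that are derived from it are at most `2 ^ B`. -/
structure InputBounded (B : ℕ) : Prop where
  n : I.n ≤ 2 ^ B
  c : I.c ≤ 2 ^ B
  numerator : num ≤ 2 ^ B
  denominator : den ≤ 2 ^ B
  profit : ∀ i, I.profitAt i ≤ 2 ^ B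
  weight : ∀ i, I.weightAt i ≤ 2 ^ B
  pen : ∀ i, I.penAt i ≤ 2 ^ B
  code : (I.c + 2) * 2 ^ I.n ≤ 2 ^ B
  scaled : I.scaledBound K num den + 1 ≤ 2 ^ B
  value : ∀ i x k, k ≤ I.n → I.profitAt i + I.codeProfit x k ≤ 2 ^ B

variable {I K num den}

theorem Vars.Bounded.st {B : ℕ} {m : Vars} (h : m.Bounded B) (hI : InputBounded I K num den B) :
    (m.st I num den).Bounded B := by
  constructor
  · rintro (_|_|_|_|_|_|_|_|_|_|_|_|_|x)
    exacts [hI.n, hI.c, hI.numerator, hI.denominator, h.j, h.i, h.v, h.pm, h.x, h.prof, h.bestVal, h.bestCode,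
      h.bound, Nat.zero_le _]
  · rintro (_|_|_|_|_|_|x)
    exacts [hI.profit, hI.weight, hI.pen, h.out, h.tab, h.pow, fun _ => Nat.zero_le _]

/-! ### Assignments as updates of the record of variables -/

namespace Vars

variable (m : Vars) (k : ℕ)

theorem setReg_j : (m.st I num den).setReg 4 k = {m with j := k}.st I num den := by
  simp only [State.setReg, st, State.mk.injEq, and_true]
  funext x
  rcases x with (_|_|_|_|_|_|_|_|_|_|_|_|_|x) <;> simp

theorem setReg_i : (m.st I num den).setReg 5 k = {m with i := k}.st I num den := by
  simp only [State.setReg, st, State.mk.injEq, and_true]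
  funext x
  rcases x with (_|_|_|_|_|_|_|_|_|_|_|_|_|x) <;> simp

theorem setReg_v : (m.st I num den).setReg 6 k = {m with v := k}.st I num den := by
  simp only [State.setReg, st, State.mk.injEq, and_true]
  funext x
  rcases x with (_|_|_|_|_|_|_|_|_|_|_|_|_|x) <;> simp

theorem setReg_pm : (m.st I num den).setReg 7 k = {m with pm := k}.st I num den := by
  simp only [State.setReg, st, State.mk.injEq, and_true]
  funext x
  rcases x with (_|_|_|_|_|_|_|_|_|_|_|_|_|x) <;> simp

theorem setReg_x : (m.st I num den).setReg 8 k = {m with x := k}.st I num den := by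
  simp only [State.setReg, st, State.mk.injEq, and_true]
  funext x
  rcases x with (_|_|_|_|_|_|_|_|_|_|_|_|_|x) <;> simp

theorem setReg_prof : (m.st I num den).setReg 9 k = {m with prof := k}.st I num den := by
  simp only [State.setReg, st, State.mk.injEq, and_true]
  funext x
  rcases x with (_|_|_|_|_|_|_|_|_|_|_|_|_|x) <;> simp

theorem setReg_bestVal : (m.st I num den).setReg 10 k = {m with bestVal := k}.st I num den := by
  simp only [State.setReg, st, State.mk.injEq, and_true]
  funext x
  rcases x with (_|_|_|_|_|_|_|_|_|_|_|_|_|x) <;> simp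

theorem setReg_bestCode : (m.st I num den).setReg 11 k = {m with bestCode := k}.st I num den := by
  simp only [State.setReg, st, State.mk.injEq, and_true]
  funext x
  rcases x with (_|_|_|_|_|_|_|_|_|_|_|_|_|x) <;> simp

theorem setReg_bound : (m.st I num den).setReg 12 k = {m with bound := k}.st I num den := by
  simp only [State.setReg, st, State.mk.injEq, and_true]
  funext x
  rcases x with (_|_|_|_|_|_|_|_|_|_|_|_|_|x) <;> simp

variable (l : ℕ)

theorem setArr_out :
    (m.st I num den).setArr 3 k l = {m with out := Function.update m.out k l}.st I num den := by
  simp only [State.setArr, st, State.mk.injEq, true_and]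
  funext x
  rcases x with (_|_|_|_|_|_|x) <;> simp

theorem setArr_tab :
    (m.st I num den).setArr 4 k l = {m with tab := Function.update m.tab k l}.st I num den := by
  simp only [State.setArr, st, State.mk.injEq, true_and]
  funext x
  rcases x with (_|_|_|_|_|_|x) <;> simp

theorem setArr_pow :
    (m.st I num den).setArr 5 k l = {m with pow := Function.update m.pow k l}.st I num den := by
  simp only [State.setArr, st, State.mk.injEq, true_and]
  funext x
  rcases x with (_|_|_|_|_|_|x) <;> simp

end Vars

variable (K)

/-- An expression for the binary digit of the code `e` at position `i`. -/
def digitExp (e : Exp) : Exp :=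
  .minus (.quot e (.get 5 (.reg 5)))
    (.times (.const 2) (.quot (.quot e (.get 5 (.reg 5))) (.const 2)))

/-- It mirrors `PKP.eligible` operation by operation, so that its value in `m.st` is `I.eligible m.j
m.i` by definition. -/
def eligibleExp : Exp :=
  .times
    (.minus (.plus (.times (.get 2 (.reg 4)) (.reg 0)) (.reg 5))
      (.plus (.times (.get 2 (.reg 5)) (.reg 0)) (.reg 4)))
    (.minus (.plus (.minus (.reg 1) (.get 1 (.reg 4))) (.const 1)) (.get 1 (.reg 5)))

def scaledExp : Exp :=
  .quot (.times (.get 0 (.reg 5)) (.times (.times (.const K) (.reg 0)) (.reg 3)))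
    (.times (.reg 7) (.reg 2))

def boundExp : Exp :=
  .times (.reg 0) (.quot (.times (.times (.const K) (.reg 0)) (.reg 3)) (.reg 2))

def itemCodeExp : Exp :=
  .plus (.times (.get 1 (.reg 5)) (.get 5 (.reg 0))) (.get 5 (.reg 5))

def codeBoundExp : Exp :=
  .times (.plus (.minus (.reg 1) (.get 1 (.reg 4))) (.const 1)) (.get 5 (.reg 0))

/-- Truncated subtraction makes `a - (a - b)` the minimum of `a` and `b`. -/
def minExp (e f : Exp) : Exp := .minus e (.minus e f)

/-- The powers of `2` and the bound on the scaled profits. -/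
def initProg : Prog :=
  .seq (.store 5 (.const 0) (.const 1)) <|
  .seq (.up 5 (.reg 0) (.store 5 (.plus (.reg 5) (.const 1))
    (.times (.const 2) (.get 5 (.reg 5))))) <|
  .assign 12 (boundExp K)

def maxProg : Prog :=
  .seq (.assign 7 (.const 0)) <|
  .up 5 (.reg 0) (.ite eligibleExp
    (.assign 7 (.plus (.reg 7) (.minus (.get 0 (.reg 5)) (.reg 7)))) .skip)

def tableInitProg : Prog :=
  .seq (.down 6 (.plus (.reg 12) (.const 1)) (.store 4 (.reg 6) codeBoundExp)) <|
  .store 4 (.const 0) (.const 0)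

/-- One array suffices: the entry at `v` depends only on positions at most `v`, and in descending
order these still hold the previous row. -/
def tableRowProg : Prog :=
  .down 6 (.plus (.reg 12) (.const 1)) (.store 4 (.reg 6) (minExp (.get 4 (.reg 6))
    (.plus (.get 4 (.minus (.reg 6) (scaledExp K))) itemCodeExp)))

def tableProg : Prog :=
  .up 5 (.reg 0) (.ite eligibleExp (tableRowProg K) .skip)

def searchProg : Prog :=
  .seq (.assign 8 (.const 0)) <|
  .up 6 (.plus (.reg 12) (.const 1))
    (.ite (.minus codeBoundExp (.get 4 (.reg 6))) (.assign 8 (.get 4 (.reg 6))) .skip)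

def profitProg : Prog :=
  .seq (.assign 9 (.const 0)) <|
  .up 5 (.reg 0)
    (.assign 9 (.plus (.reg 9) (.times (.get 0 (.reg 5)) (digitExp (.reg 8)))))

def updateProg : Prog :=
  .ite (.minus (.plus (.get 0 (.reg 4)) (.reg 9)) (.plus (.get 2 (.reg 4)) (.reg 10)))
    (.seq (.assign 11 (.plus (.reg 8) (.get 5 (.reg 4))))
      (.assign 10 (.minus (.plus (.get 0 (.reg 4)) (.reg 9)) (.get 2 (.reg 4)))))
    .skip

def leadingProg : Prog :=
  .seq maxProg <| .seq tableInitProg <| .seq (tableProg K) <| .seq searchProg <|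
  .seq profitProg updateProg

def mainLoop : Prog :=
  .up 4 (.reg 0)
    (.ite (.minus (.plus (.reg 1) (.const 1)) (.get 1 (.reg 4))) (leadingProg K) .skip)

def outputProg : Prog :=
  .up 5 (.reg 0) (.store 3 (.reg 5) (digitExp (.reg 11)))

/-- The approximation scheme: the algorithm `A(ε / K)`. -/
def prog : Prog := .seq (initProg K) <| .seq (mainLoop K) outputProg

end KnapsackProgram

/-! ### Bounds on the intermediate values -/

namespace PKP

variable (I : PKP) {K num den : ℕ}

theorem maxProfit_le {M : ℕ} (h : ∀ i, I.profitAt i ≤ M) (j k : ℕ) : I.maxProfit j k ≤ M := by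
  induction k with
  | zero => exact Nat.zero_le _
  | succ k ih =>
    rw [maxProfit]
    have := h k
    split_ifs <;> omega

theorem codeBound_le (j : ℕ) : I.codeBound j ≤ (I.c + 1) * 2 ^ I.n := by
  unfold codeBound
  gcongr
  omega

theorem table_le (j k v : ℕ) : I.table K num den j k v ≤ I.codeBound j := by
  induction k generalizing v with
  | zero => rw [table]; split_ifs <;> simp
  | succ k ih =>
    rw [table]
    split_ifs
    · exact ih v
    · exact (min_le_left _ _).trans (ih v)

theorem best_le (j k : ℕ) : I.best K num den j k ≤ I.codeBound j := by
  induction k with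
  | zero => exact Nat.zero_le _
  | succ k ih =>
    rw [best]
    split_ifs
    · exact ih
    · exact I.table_le j _ _

end PKP

namespace KnapsackProgram

variable {I : PKP} {K num den B : ℕ}

theorem InputBounded.codeBound (hI : InputBounded I K num den B) (j : ℕ) :
    I.codeBound j ≤ 2 ^ B := by
  refine (I.codeBound_le j).trans (le_trans ?_ hI.code)
  gcongr
  omega

theorem InputBounded.table (hI : InputBounded I K num den B) (j k v : ℕ) :
    I.table K num den j k v ≤ 2 ^ B :=
  (I.table_le j k v).trans (hI.codeBound j)

theorem InputBounded.best (hI : InputBounded I K num den B) (j k : ℕ) :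
    I.best K num den j k ≤ 2 ^ B :=
  (I.best_le j k).trans (hI.codeBound j)

theorem InputBounded.codeProfit (hI : InputBounded I K num den B) (x : ℕ) {k : ℕ} (hk : k ≤ I.n) :
    I.codeProfit x k ≤ 2 ^ B :=
  (Nat.le_add_left _ _).trans (hI.value 0 x k hk)

theorem InputBounded.pow (hI : InputBounded I K num den B) {k : ℕ} (hk : k ≤ I.n) :
    2 ^ k ≤ 2 ^ B := by
  have h1 : 2 ^ k ≤ 2 ^ I.n := Nat.pow_le_pow_right (by norm_num) hk
  exact h1.trans ((Nat.le_mul_of_pos_left _ (by omega)).trans hI.code)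

/-! ### Runs and step counts of the subprograms -/

theorem maxProg_runs (hB : 1 ≤ B) (hI : InputBounded I K num den B) {m : Vars} (hm : m.Bounded B)
    (hi : m.i = 0) :
    Runs (K + 100) B maxProg (m.st I num den)
      ({m with pm := I.maxProfit m.j I.n}.st I num den) (I.n * 4 + 3) := by
  have hmax := fun k => I.maxProfit_le hI.profit m.j k
  have h1 : Runs (K + 100) B (.assign 7 (.const 0)) (m.st I num den)
      ({m with pm := 0}.st I num den) 1 :=
    Runs.assign hB (hm.st hI) (by simp only [Exp.nodes]; omega) (m.setReg_pm 0)
  have hb : ∀ k ≤ I.n, Vars.Bounded B {m with i := k, pm := I.maxProfit m.j k} :=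
    fun k hk => { hm with i := hk.trans hI.n, pm := hmax k }
  have h2 := Runs.up (m := K + 100) (N := 2) (x := 5) (n := I.n) (e := .reg 0)
    (P := .ite eligibleExp
      (.assign 7 (.plus (.reg 7) (.minus (.get 0 (.reg 5)) (.reg 7)))) .skip) hB (by omega)
    (by simp only [Exp.nodes]; omega)
    (fun k => {m with i := k, pm := I.maxProfit m.j k}.st I num den)
    (fun k _ => rfl) (fun k _ => rfl)
    (fun k hk => (hb k hk).st hI)
    (fun k hk => by
      refine Runs.ite hB ((hb k hk.le).st hI) (by simp only [eligibleExp, Exp.nodes]; omega)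
        (fun h => ?_) (fun h => ?_)
      · refine Runs.assign hB ((hb k hk.le).st hI) (by simp only [Exp.nodes]; omega) ?_
        rw [Vars.setReg_pm, Vars.setReg_i]
        simp only [PKP.maxProfit]
        rw [if_neg (show ¬ I.eligible m.j k = 0 from h)]
        rfl
      · rw [Vars.setReg_i]
        simp only [PKP.maxProfit]
        rw [if_pos (show I.eligible m.j k = 0 from h)]
        exact Runs.skip)
  rw [Vars.setReg_i] at h2
  refine (Runs.seq h1 ?_).mono (N₁ := 1 + (I.n * 4 + 2)) (by omega)
  convert h2 using 2
  · simp only [PKP.maxProfit, hi]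
  · simp only [hi]

theorem tableInitProg_runs (hB : 1 ≤ B) (hI : InputBounded I K num den B) {m : Vars}
    (hm : m.Bounded B) (hv : m.v = 0) (hbound : m.bound = I.scaledBound K num den)
    (hpow : ∀ k ≤ I.n, m.pow k = 2 ^ k) :
    Runs (K + 100) B tableInitProg (m.st I num den)
      ({m with tab := (fun v => if v ≤ m.bound then I.table K num den m.j 0 v
          else m.tab v)}.st I num den) ((m.bound + 1) * 3 + 3) := by
  have hcb := hI.codeBound m.j
  have hb : ∀ k l, l ≤ m.bound + 1 → Vars.Bounded B {m with v := l, tab := (fun v =>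
      if k ≤ v ∧ v ≤ m.bound then I.codeBound m.j else m.tab v)} := fun k l hk =>
    { hm with
      v := hk.trans (hbound ▸ hI.scaled)
      tab := fun v => by
        change (if k ≤ v ∧ v ≤ m.bound then I.codeBound m.j else m.tab v) ≤ 2 ^ B
        split_ifs
        · exact hcb
        · exact hm.tab v }
  have h1 := Runs.down (m := K + 100) (N := 1) (x := 6) (n := m.bound + 1)
    (e := .plus (.reg 12) (.const 1))
    (P := .store 4 (.reg 6) codeBoundExp) hB (by omega)
    (by simp only [Exp.nodes]; omega) (hm.st hI)
    (fun k => {m with v := k, tab := (fun v =>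
      if k ≤ v ∧ v ≤ m.bound then I.codeBound m.j else m.tab v)}.st I num den)
    (by
      change (m.st I num den).setReg 6 (m.bound + 1) = _
      rw [Vars.setReg_v]
      congr 2
      funext v
      rw [if_neg (by omega)])
    (fun k _ => rfl) (fun k hk => (hb k k hk).st hI)
    (fun k hk => by
      rw [Vars.setReg_v]
      refine Runs.store hB ((hb (k + 1) k hk.le).st hI)
        (by simp only [codeBoundExp, Exp.nodes]; omega) ?_
      have e : Exp.eval (Vars.st I num den {m with v := k, tab := (fun v =>
          if k + 1 ≤ v ∧ v ≤ m.bound then I.codeBound m.j else m.tab v)}) codeBoundExp =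
          I.codeBound m.j := by
        change (I.c - I.weightAt m.j + 1) * m.pow I.n = _
        rw [hpow _ le_rfl]
        rfl
      rw [e, Vars.setArr_tab]
      congr 2
      funext v
      dsimp only
      change Function.update _ k _ v = _
      by_cases hvk : v = k
      · subst hvk
        rw [Function.update_self, if_pos ⟨le_rfl, by omega⟩]
      · rw [Function.update_of_ne hvk]
        congr 1
        simp only [eq_iff_iff]
        omega)
  refine (h1.seq (Runs.store hB ((hb 0 0 (by omega)).st hI) (by simp only [Exp.nodes]; omega)
    ?_)).mono (by omega)
  change State.setArr _ 4 0 0 = _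
  rw [Vars.setArr_tab]
  simp only [hv]
  congr 2
  funext v
  by_cases h0 : v = 0
  · subst h0
    simp [PKP.table]
  · rw [Function.update_of_ne h0]
    simp [PKP.table, h0]

theorem tableRowProg_runs (hB : 1 ≤ B) (hI : InputBounded I K num den B) {m : Vars}
    (hm : m.Bounded B) (hv : m.v = 0) (hi : m.i ≤ I.n)
    (hbound : m.bound = I.scaledBound K num den) (hpow : ∀ k ≤ I.n, m.pow k = 2 ^ k)
    (hpm : m.pm = I.maxProfit m.j I.n) :
    Runs (K + 100) B (tableRowProg K) (m.st I num den)
      ({m with tab := (fun v => if v ≤ m.bound then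
          min (m.tab v) (m.tab (v - I.scaled K num den m.j m.i) + I.itemCode m.i)
          else m.tab v)}.st I num den) ((m.bound + 1) * 3 + 2) := by
  set new : ℕ → ℕ := fun v =>
    min (m.tab v) (m.tab (v - I.scaled K num den m.j m.i) + I.itemCode m.i) with hnew
  have hb : ∀ k l, l ≤ m.bound + 1 → Vars.Bounded B {m with v := l, tab := (fun v =>
      if k ≤ v ∧ v ≤ m.bound then new v else m.tab v)} := fun k l hk =>
    { hm with
      v := hk.trans (hbound ▸ hI.scaled)
      tab := fun v => by
        change (if k ≤ v ∧ v ≤ m.bound then new v else m.tab v) ≤ 2 ^ B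
        split_ifs
        · exact (min_le_left _ _).trans (hm.tab v)
        · exact hm.tab v }
  have h1 := Runs.down (m := K + 100) (N := 1) (x := 6) (n := m.bound + 1)
    (e := .plus (.reg 12) (.const 1))
    (P := .store 4 (.reg 6) (minExp (.get 4 (.reg 6))
      (.plus (.get 4 (.minus (.reg 6) (scaledExp K))) itemCodeExp))) hB (by omega)
    (by simp only [Exp.nodes]; omega) (hm.st hI)
    (fun k => {m with v := k, tab := (fun v =>
      if k ≤ v ∧ v ≤ m.bound then new v else m.tab v)}.st I num den)
    (by
      change (m.st I num den).setReg 6 (m.bound + 1) = _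
      rw [Vars.setReg_v]
      congr 2
      funext v
      rw [if_neg (by omega)])
    (fun k _ => rfl) (fun k hk => (hb k k hk).st hI)
    (fun k hk => by
      rw [Vars.setReg_v]
      refine Runs.store hB ((hb (k + 1) k hk.le).st hI)
        (by simp only [minExp, scaledExp, itemCodeExp, Exp.nodes]; omega) ?_
      have e : Exp.eval (Vars.st I num den {m with v := k, tab := (fun v =>
          if k + 1 ≤ v ∧ v ≤ m.bound then new v else m.tab v)}) (minExp (.get 4 (.reg 6))
          (.plus (.get 4 (.minus (.reg 6) (scaledExp K))) itemCodeExp)) = new k := by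
        have h1 : ∀ l ≤ k, (if k + 1 ≤ l ∧ l ≤ m.bound then new l else m.tab l) =
            m.tab l := fun l hl => if_neg (by omega)
        have h2 : ∀ T : ℕ → ℕ, Exp.eval (Vars.st I num den {m with v := k, tab := T})
            (minExp (.get 4 (.reg 6))
            (.plus (.get 4 (.minus (.reg 6) (scaledExp K))) itemCodeExp)) =
            T k - (T k - (T (k - I.profitAt m.i * (K * I.n * den) / (m.pm * num)) +
              (I.weightAt m.i * m.pow I.n + m.pow m.i))) := fun T => rfl
        rw [h2, h1 _ le_rfl, h1 _ (Nat.sub_le _ _), hpow _ le_rfl, hpow _ hi, hpm]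
        exact (by omega : ∀ a b : ℕ, a - (a - b) = min a b) _ _
      rw [e, Vars.setArr_tab]
      congr 2
      funext v
      dsimp only
      change Function.update _ k _ v = _
      by_cases hvk : v = k
      · subst hvk
        rw [Function.update_self, if_pos ⟨le_rfl, by omega⟩]
      · rw [Function.update_of_ne hvk]
        congr 1
        simp only [eq_iff_iff]
        omega)
  simp only [hv, Nat.zero_le, true_and] at h1 ⊢
  exact h1

theorem tableProg_runs (hB : 1 ≤ B) (hI : InputBounded I K num den B) {m : Vars}
    (hm : m.Bounded B) (hv : m.v = 0) (hi : m.i = 0)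
    (hbound : m.bound = I.scaledBound K num den) (hpow : ∀ k ≤ I.n, m.pow k = 2 ^ k)
    (hpm : m.pm = I.maxProfit m.j I.n) :
    Runs (K + 100) B (tableProg K)
      ({m with tab := (fun v => if v ≤ m.bound then I.table K num den m.j 0 v
        else m.tab v)}.st I num den)
      ({m with tab := (fun v => if v ≤ m.bound then I.table K num den m.j I.n v
        else m.tab v)}.st I num den) (I.n * ((m.bound + 1) * 3 + 5) + 2) := by
  have hb : ∀ k l, k ≤ I.n → Vars.Bounded B {m with i := k, tab := (fun v =>
      if v ≤ m.bound then I.table K num den m.j l v else m.tab v)} := fun k l hk =>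
    { hm with
      i := hk.trans hI.n
      tab := fun v => by
        change (if v ≤ m.bound then I.table K num den m.j l v else m.tab v) ≤ 2 ^ B
        split_ifs
        · exact hI.table _ _ _
        · exact hm.tab v }
  have h2 := Runs.up (m := K + 100) (N := (m.bound + 1) * 3 + 2 + 1) (x := 5) (n := I.n)
    (e := .reg 0) (P := .ite eligibleExp (tableRowProg K) .skip) hB (by omega)
    (by simp only [Exp.nodes]; omega)
    (fun k => {m with i := k, tab := (fun v =>
      if v ≤ m.bound then I.table K num den m.j k v else m.tab v)}.st I num den)
    (fun k _ => rfl) (fun k _ => rfl)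
    (fun k hk => (hb k k hk).st hI)
    (fun k hk => by
      refine Runs.ite hB ((hb k k hk.le).st hI) (by simp only [eligibleExp, Exp.nodes]; omega)
        (fun h => ?_) (fun h => ?_)
      · have := tableRowProg_runs hB hI (hb k k hk.le) hv hk.le hbound hpow hpm
        rw [Vars.setReg_i]
        convert this using 3
        funext v
        by_cases hvb : v ≤ m.bound
        · have hvb' : v - I.scaled K num den m.j k ≤ m.bound := (Nat.sub_le _ _).trans hvb
          simp only [PKP.table, if_pos hvb, if_pos hvb']
          rw [if_neg (show ¬ I.eligible m.j k = 0 from h)]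
        · simp only [if_neg hvb]
      · rw [Vars.setReg_i]
        simp only [PKP.table, show I.eligible m.j k = 0 from h, if_true]
        exact Runs.skip.mono (by omega))
  rw [Vars.setReg_i] at h2
  refine Runs.mono (N₁ := I.n * ((m.bound + 1) * 3 + 2 + 1 + 2) + 2) ?_ le_rfl
  simp only [hi] at h2 ⊢
  exact h2

theorem searchProg_runs (hB : 1 ≤ B) (hI : InputBounded I K num den B) {m : Vars}
    (hm : m.Bounded B) (hv : m.v = 0) (hbound : m.bound = I.scaledBound K num den)
    (hpow : ∀ k ≤ I.n, m.pow k = 2 ^ k)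
    (htab : ∀ v ≤ m.bound, m.tab v = I.table K num den m.j I.n v) :
    Runs (K + 100) B searchProg (m.st I num den)
      ({m with x := I.best K num den m.j (m.bound + 1)}.st I num den)
      ((m.bound + 1) * 4 + 3) := by
  have h1 : Runs (K + 100) B (.assign 8 (.const 0)) (m.st I num den)
      ({m with x := 0}.st I num den) 1 :=
    Runs.assign hB (hm.st hI) (by simp only [Exp.nodes]; omega) (m.setReg_x 0)
  have hb : ∀ k ≤ m.bound + 1, Vars.Bounded B {m with v := k, x := I.best K num den m.j k} :=
    fun k hk => { hm with v := hk.trans (hbound ▸ hI.scaled), x := hI.best _ _ }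
  have h2 := Runs.up (m := K + 100) (N := 2) (x := 6) (n := m.bound + 1)
    (e := .plus (.reg 12) (.const 1))
    (P := .ite (.minus codeBoundExp (.get 4 (.reg 6))) (.assign 8 (.get 4 (.reg 6))) .skip)
    hB (by omega) (by simp only [Exp.nodes]; omega)
    (fun k => {m with v := k, x := I.best K num den m.j k}.st I num den)
    (fun k _ => rfl) (fun k _ => rfl)
    (fun k hk => (hb k hk).st hI)
    (fun k hk => by
      have ht := htab k (by omega)
      have e : Exp.eval (Vars.st I num den {m with v := k, x := I.best K num den m.j k})
          (.minus codeBoundExp (.get 4 (.reg 6))) =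
          I.codeBound m.j - I.table K num den m.j I.n k := by
        change (I.c - I.weightAt m.j + 1) * m.pow I.n - m.tab k = _
        rw [hpow _ le_rfl, ht]
        rfl
      refine Runs.ite hB ((hb k hk.le).st hI)
        (by simp only [codeBoundExp, Exp.nodes]; omega) (fun h => ?_) (fun h => ?_)
      · rw [e] at h
        refine Runs.assign hB ((hb k hk.le).st hI) (by simp only [Exp.nodes]; omega) ?_
        rw [Vars.setReg_x, Vars.setReg_v]
        simp only [PKP.best]
        rw [if_neg h, ← ht]
        rfl
      · rw [e] at h
        rw [Vars.setReg_v]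
        simp only [PKP.best]
        rw [if_pos h]
        exact Runs.skip)
  rw [Vars.setReg_v] at h2
  refine (Runs.seq h1 ?_).mono (N₁ := 1 + ((m.bound + 1) * 4 + 2)) (by omega)
  convert h2 using 2
  · simp only [PKP.best, hv]
  · simp only [hv]

theorem profitProg_runs (hB : 1 ≤ B) (hI : InputBounded I K num den B) {m : Vars}
    (hm : m.Bounded B) (hi : m.i = 0) (hpow : ∀ k ≤ I.n, m.pow k = 2 ^ k) :
    Runs (K + 100) B profitProg (m.st I num den)
      ({m with prof := I.codeProfit m.x I.n}.st I num den) (I.n * 3 + 3) := by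
  have h1 : Runs (K + 100) B (.assign 9 (.const 0)) (m.st I num den)
      ({m with prof := 0}.st I num den) 1 :=
    Runs.assign hB (hm.st hI) (by simp only [Exp.nodes]; omega) (m.setReg_prof 0)
  have hb : ∀ k ≤ I.n, Vars.Bounded B {m with i := k, prof := I.codeProfit m.x k} :=
    fun k hk => { hm with i := hk.trans hI.n, prof := hI.codeProfit _ hk }
  have h2 := Runs.up (m := K + 100) (N := 1) (x := 5) (n := I.n) (e := .reg 0)
    (P := .assign 9 (.plus (.reg 9) (.times (.get 0 (.reg 5)) (digitExp (.reg 8)))))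
    hB (by omega) (by simp only [Exp.nodes]; omega)
    (fun k => {m with i := k, prof := I.codeProfit m.x k}.st I num den)
    (fun k _ => rfl) (fun k _ => rfl)
    (fun k hk => (hb k hk).st hI)
    (fun k hk => by
      refine Runs.assign hB ((hb k hk.le).st hI) (by simp only [digitExp, Exp.nodes]; omega) ?_
      rw [Vars.setReg_prof, Vars.setReg_i]
      congr 2
      change I.codeProfit m.x k + I.profitAt k *
        (m.x / m.pow k - 2 * (m.x / m.pow k / 2)) = _
      rw [hpow k hk.le]
      rfl)
  rw [Vars.setReg_i] at h2
  refine (Runs.seq h1 ?_).mono (N₁ := 1 + (I.n * 3 + 2)) (by omega)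
  convert h2 using 2
  · simp only [PKP.codeProfit, hi]
  · simp only [hi]

theorem outputProg_runs (hB : 1 ≤ B) (hI : InputBounded I K num den B) {m : Vars}
    (hm : m.Bounded B) (hi : m.i = 0) (hpow : ∀ k ≤ I.n, m.pow k = 2 ^ k) :
    Runs (K + 100) B outputProg (m.st I num den)
      ({m with out := (fun i => if i < I.n then binaryDigit m.bestCode i
        else m.out i)}.st I num den) (I.n * 3 + 2) := by
  have hb : ∀ k ≤ I.n, Vars.Bounded B {m with i := k, out := (fun i =>
      if i < k then binaryDigit m.bestCode i else m.out i)} :=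
    fun k hk =>
      { hm with
        i := hk.trans hI.n
        out := fun i => by
          change (if i < k then binaryDigit m.bestCode i else m.out i) ≤ 2 ^ B
          split_ifs
          · exact (Nat.sub_le _ _).trans ((Nat.div_le_self _ _).trans hm.bestCode)
          · exact hm.out i }
  have h2 := Runs.up (m := K + 100) (N := 1) (x := 5) (n := I.n) (e := .reg 0)
    (P := .store 3 (.reg 5) (digitExp (.reg 11)))
    hB (by omega) (by simp only [Exp.nodes]; omega)
    (fun k => {m with i := k, out := (fun i =>
      if i < k then binaryDigit m.bestCode i else m.out i)}.st I num den)
    (fun k _ => rfl) (fun k _ => rfl)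
    (fun k hk => (hb k hk).st hI)
    (fun k hk => by
      refine Runs.store hB ((hb k hk.le).st hI) (by simp only [digitExp, Exp.nodes]; omega) ?_
      have e : Exp.eval (Vars.st I num den {m with i := k, out := (fun i =>
          if i < k then binaryDigit m.bestCode i else m.out i)}) (digitExp (.reg 11)) =
          binaryDigit m.bestCode k := by
        change m.bestCode / m.pow k - 2 * (m.bestCode / m.pow k / 2) = _
        rw [hpow k hk.le]
        rfl
      rw [e, Vars.setArr_out, Vars.setReg_i]
      congr 2
      funext i
      dsimp only
      change Function.update _ k _ i = _
      by_cases hik : i = k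
      · subst hik
        rw [Function.update_self, if_pos (by omega)]
      · rw [Function.update_of_ne hik]
        congr 1
        simp only [eq_iff_iff]
        omega)
  rw [Vars.setReg_i] at h2
  have e : m = {m with i := 0, out := (fun i =>
      if i < 0 then binaryDigit m.bestCode i else m.out i)} := by
    simp only [Nat.not_lt_zero, if_false]
    rw [← hi]
  rw [← e] at h2
  simp only [hi]
  exact h2

theorem initProg_runs (hB : 1 ≤ B) (hI : InputBounded I K num den B) {m : Vars}
    (hm : m.Bounded B) (hi : m.i = 0) (hpow : m.pow = fun _ => 0) :
    Runs (K + 100) B (initProg K) (m.st I num den)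
      ({m with
        bound := I.scaledBound K num den
        pow := (fun i => if i ≤ I.n then 2 ^ i else 0) }.st I num den) (I.n * 3 + 4) := by
  have hb : ∀ k ≤ I.n, Vars.Bounded B {m with i := k, pow := (fun i =>
      if i ≤ k then 2 ^ i else 0)} :=
    fun k hk =>
      { hm with
        i := hk.trans hI.n
        pow := fun i => by
          change (if i ≤ k then 2 ^ i else 0) ≤ 2 ^ B
          split_ifs with h
          · exact hI.pow (h.trans hk)
          · exact Nat.zero_le _ }
  have h1 : Runs (K + 100) B (.store 5 (.const 0) (.const 1)) (m.st I num den)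
      ({m with i := 0, pow := (fun i => if i ≤ 0 then 2 ^ i else 0)}.st I num den) 1 := by
    refine Runs.store hB (hm.st hI) (by simp only [Exp.nodes]; omega) ?_
    rw [Vars.setArr_pow]
    simp only [hi, hpow]
    congr 2
    funext i
    change Function.update _ 0 1 i = _
    by_cases h0 : i = 0
    · subst h0
      simp
    · rw [Function.update_of_ne h0, if_neg (by omega)]
  have h2 := Runs.up (m := K + 100) (N := 1) (x := 5) (n := I.n) (e := .reg 0)
    (P := .store 5 (.plus (.reg 5) (.const 1)) (.times (.const 2) (.get 5 (.reg 5))))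
    hB (by omega) (by simp only [Exp.nodes]; omega)
    (fun k => {m with i := k, pow := (fun i => if i ≤ k then 2 ^ i else 0)}.st I num den)
    (fun k _ => rfl) (fun k _ => rfl)
    (fun k hk => (hb k hk).st hI)
    (fun k hk => by
      refine Runs.store hB ((hb k hk.le).st hI) (by simp only [Exp.nodes]; omega) ?_
      have e : Exp.eval (Vars.st I num den {m with i := k, pow := (fun i =>
          if i ≤ k then 2 ^ i else 0)}) (.times (.const 2) (.get 5 (.reg 5))) = 2 ^ (k + 1) := by
        change 2 * (if k ≤ k then 2 ^ k else 0) = _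
        rw [if_pos le_rfl, pow_succ, mul_comm]
      rw [e, Vars.setArr_pow, Vars.setReg_i]
      congr 2
      funext i
      dsimp only
      change Function.update _ (k + 1) _ i = _
      by_cases hik : i = k + 1
      · subst hik
        rw [Function.update_self, if_pos le_rfl]
      · rw [Function.update_of_ne hik]
        congr 1
        simp only [eq_iff_iff]
        omega)
  rw [Vars.setReg_i] at h2
  refine (h1.seq (h2.seq (Runs.assign hB (Vars.Bounded.st ?_ hI)
    (by simp only [boundExp, Exp.nodes]; omega) ?_))).mono (N₁ := 1 + (I.n * 3 + 2 + 1)) (by omega)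
  · exact { hb I.n le_rfl with i := Nat.zero_le _ }
  · rw [Vars.setReg_bound]
    simp only [hi]
    rfl

theorem updateProg_runs (hB : 1 ≤ B) (hI : InputBounded I K num den B) {m : Vars}
    (hm : m.Bounded B) (hj : m.j ≤ I.n) (hpow : ∀ k ≤ I.n, m.pow k = 2 ^ k)
    (hx : m.x ≤ I.codeBound m.j) (hprof : m.prof = I.codeProfit m.x I.n) :
    ∃ m' : Vars, Runs (K + 100) B updateProg (m.st I num den) (m'.st I num den) 3 ∧
      m'.Bounded B ∧ m'.j = m.j ∧ m'.i = m.i ∧ m'.v = m.v ∧ m'.bound = m.bound ∧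
      m'.pow = m.pow ∧
      (m'.bestVal, m'.bestCode) =
        if I.profitAt m.j + m.prof - (I.penAt m.j + m.bestVal) = 0 then (m.bestVal, m.bestCode)
        else (I.profitAt m.j + m.prof - I.penAt m.j, m.x + 2 ^ m.j) := by
  by_cases h : I.profitAt m.j + m.prof - (I.penAt m.j + m.bestVal) = 0
  · refine ⟨m, ?_, hm, rfl, rfl, rfl, rfl, rfl, by rw [if_pos h]⟩
    exact Runs.ite hB (hm.st hI) (by simp only [Exp.nodes]; omega) (fun h' => absurd h h')
      (fun _ => Runs.skip.mono (by omega))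
  -- The bit of the leading item comes on top of a code bounded by `codeBound`; this is why
  -- `InputBounded.code` has `c + 2` and not `c + 1`.
  · have hcode : m.x + 2 ^ m.j ≤ 2 ^ B := by
      refine le_trans ?_ hI.code
      have h1 : 2 ^ m.j ≤ 2 ^ I.n := Nat.pow_le_pow_right (by norm_num) hj
      have h2 := I.codeBound_le m.j
      calc m.x + 2 ^ m.j ≤ (I.c + 1) * 2 ^ I.n + 2 ^ I.n := by omega
        _ = (I.c + 2) * 2 ^ I.n := by ring
    have hval : I.profitAt m.j + m.prof - I.penAt m.j ≤ 2 ^ B :=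
      (Nat.sub_le _ _).trans (hprof ▸ hI.value _ _ _ le_rfl)
    have hm1 : Vars.Bounded B {m with bestCode := m.x + 2 ^ m.j} := { hm with bestCode := hcode }
    have hm2 : Vars.Bounded B {m with
      bestCode := m.x + 2 ^ m.j, bestVal := I.profitAt m.j + m.prof - I.penAt m.j} :=
      { hm with bestCode := hcode, bestVal := hval }
    refine ⟨_, ?_, hm2, rfl, rfl, rfl, rfl, rfl, by rw [if_neg h]⟩
    refine Runs.ite (N := 2) hB (hm.st hI) (by simp only [Exp.nodes]; omega)
      (fun _ => ?_) (fun h' => absurd h' h)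
    refine (Runs.assign hB (hm.st hI) (by simp only [Exp.nodes]; omega) ?_).seq
      (Runs.assign (s := Vars.st I num den {m with bestCode := m.x + 2 ^ m.j}) hB (hm1.st hI)
        (by simp only [Exp.nodes]; omega) ?_)
    · rw [Vars.setReg_bestCode]
      congr 2
      change m.x + m.pow m.j = _
      rw [hpow _ hj]
    · rw [Vars.setReg_bestVal]
      rfl

theorem leadingProg_runs (hB : 1 ≤ B) (hI : InputBounded I K num den B) {m : Vars}
    (hm : m.Bounded B) (hi : m.i = 0) (hv : m.v = 0) (hj : m.j ≤ I.n)
    (hbound : m.bound = I.scaledBound K num den) (hpow : ∀ k ≤ I.n, m.pow k = 2 ^ k) :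
    ∃ m' : Vars, Runs (K + 100) B (leadingProg K) (m.st I num den) (m'.st I num den)
        (40 * ((I.n + 1) * (I.scaledBound K num den + 1))) ∧
      m'.Bounded B ∧ m'.j = m.j ∧ m'.i = 0 ∧ m'.v = 0 ∧ m'.bound = m.bound ∧
      m'.pow = m.pow ∧
      (m'.bestVal, m'.bestCode) =
        let x := I.best K num den m.j (I.scaledBound K num den + 1)
        if I.profitAt m.j + I.codeProfit x I.n - (I.penAt m.j + m.bestVal) = 0 then
          (m.bestVal, m.bestCode)
        else (I.profitAt m.j + I.codeProfit x I.n - I.penAt m.j, x + 2 ^ m.j) := by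
  have hb1 : Vars.Bounded B {m with pm := I.maxProfit m.j I.n} :=
    { hm with pm := I.maxProfit_le hI.profit m.j I.n }
  have hb3 : Vars.Bounded B {m with
      pm := I.maxProfit m.j I.n
      tab := (fun v => if v ≤ m.bound then I.table K num den m.j I.n v else m.tab v)} :=
    { hb1 with
      tab := fun v => by
        change (if v ≤ m.bound then I.table K num den m.j I.n v else m.tab v) ≤ 2 ^ B
        split_ifs
        · exact hI.table _ _ _
        · exact hm.tab v }
  have hb4 : Vars.Bounded B {m with
      pm := I.maxProfit m.j I.n
      tab := (fun v => if v ≤ m.bound then I.table K num den m.j I.n v else m.tab v)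
      x := I.best K num den m.j (m.bound + 1)} := { hb3 with x := hI.best _ _ }
  have hb5 : Vars.Bounded B {m with
      pm := I.maxProfit m.j I.n
      tab := (fun v => if v ≤ m.bound then I.table K num den m.j I.n v else m.tab v)
      x := I.best K num den m.j (m.bound + 1)
      prof := I.codeProfit (I.best K num den m.j (m.bound + 1)) I.n} :=
    { hb4 with prof := hI.codeProfit _ le_rfl }
  have h1 := maxProg_runs hB hI hm hi
  have h2 := tableInitProg_runs hB hI hb1 hv hbound hpow
  have h3 := tableProg_runs hB hI hb1 hv hi hbound hpow rfl
  have h4 := searchProg_runs hB hI hb3 hv hbound hpow (fun v hv => if_pos hv)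
  have h5 := profitProg_runs hB hI hb4 hi hpow
  obtain ⟨m', h6, hm', e1, e2, e3, e4, e5, e6⟩ :=
    updateProg_runs hB hI hb5 hj hpow (I.best_le _ _) rfl
  refine ⟨m', (h1.seq (h2.seq (h3.seq (h4.seq (h5.seq h6))))).mono ?_, hm', e1, e2.trans hi,
    e3.trans hv, e4, e5, ?_⟩
  · change _ + ((m.bound + 1) * 3 + 3 + (I.n * ((m.bound + 1) * 3 + 5) + 2 +
      ((m.bound + 1) * 4 + 3 + _))) ≤ _
    rw [← hbound]
    nlinarith [Nat.zero_le (I.n * m.bound)]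
  · rw [← hbound]
    exact e6

theorem mainLoop_runs (hB : 1 ≤ B) (hI : InputBounded I K num den B) {m : Vars}
    (hm : m.Bounded B) (hi : m.i = 0) (hv : m.v = 0) (hj : m.j = 0)
    (hbound : m.bound = I.scaledBound K num den) (hpow : ∀ k ≤ I.n, m.pow k = 2 ^ k)
    (hval : m.bestVal = 0) (hcode : m.bestCode = 0) :
    ∃ m' : Vars, Runs (K + 100) B (mainLoop K) (m.st I num den) (m'.st I num den)
        (I.n * (40 * ((I.n + 1) * (I.scaledBound K num den + 1)) + 3) + 2) ∧
      m'.Bounded B ∧ m'.i = 0 ∧ m'.pow = m.pow ∧ m'.bestCode = (I.result K num den I.n).2 := by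
  obtain ⟨s', ⟨m', rfl, h1, h2, h3, h4, h5, h6, h7⟩, hr⟩ := Runs.up_of_invariant
    (m := K + 100) (N := 40 * ((I.n + 1) * (I.scaledBound K num den + 1)) + 1)
    (x := 4) (n := I.n) (e := .reg 0)
    (P := .ite (.minus (.plus (.reg 1) (.const 1)) (.get 1 (.reg 4))) (leadingProg K) .skip)
    hB (by omega) (by simp only [Exp.nodes]; omega)
    -- The invariant leaves the scratch variables (table, `x`, `prof`, `pm`) unspecified: what the
    -- previous leading item left there is overwritten before it is read.
    (fun k s => ∃ m' : Vars, s = m'.st I num den ∧ m'.j = k ∧ m'.Bounded B ∧ m'.i = 0 ∧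
      m'.v = 0 ∧ m'.bound = m.bound ∧ m'.pow = m.pow ∧
      (m'.bestVal, m'.bestCode) = I.result K num den k)
    (by
      rintro k hk s ⟨m', rfl, h1, h2, -⟩
      exact ⟨h1, rfl, h2.st hI⟩)
    (by
      rintro k hk s ⟨m', rfl, h1, h2, h3, h4, h5, h6, h7⟩
      subst h1
      have hnext : m'.j + 1 ≤ 2 ^ B := le_trans hk hI.n
      have h8 := Prod.ext_iff.1 h7
      simp only at h8
      by_cases h : I.c + 1 - I.weightAt m'.j = 0
      · refine ⟨_, ⟨{m' with j := m'.j + 1}, rfl, rfl, { h2 with j := hnext }, h3, h4, h5, h6, ?_⟩,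
          ?_⟩
        · rw [PKP.result, if_pos h]
          exact h7
        · rw [Vars.setReg_j]
          exact Runs.ite hB (h2.st hI) (by simp only [Exp.nodes]; omega) (fun h' => absurd h h')
            (fun _ => Runs.skip.mono (by nlinarith [Nat.zero_le (I.n * I.scaledBound K num den)]))
      · obtain ⟨m₁, hr, e1, e2, e3, e4, e5, e6, e7⟩ := leadingProg_runs hB hI h2 h3 h4 hk.le
          (h5.trans hbound) (by rw [h6]; exact hpow)
        refine ⟨_, ⟨{m₁ with j := m'.j + 1}, rfl, rfl, { e1 with j := hnext }, e3, e4,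
          e5.trans h5, e6.trans h6, ?_⟩, ?_⟩
        · rw [PKP.result, if_neg h, ← h8.1, ← h7]
          exact e7
        · rw [Vars.setReg_j]
          dsimp only
          rw [← e2]
          exact Runs.ite hB (h2.st hI) (by simp only [Exp.nodes]; omega) (fun _ => hr)
            (fun h' => absurd h' h))
    ⟨m, rfl, hj, hm, hi, hv, rfl, rfl, by rw [hval, hcode, PKP.result]⟩
  rw [Vars.setReg_j] at hr
  exact ⟨_, hr, { h2 with j := Nat.zero_le _ }, h3, h6, congrArg Prod.snd h7⟩

/-- The program writes the binary digits of the code of the best set into array `3`. -/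
theorem prog_runs (hB : 1 ≤ B) (hI : InputBounded I K num den B) {m : Vars}
    (hm : m.Bounded B) (hi : m.i = 0) (hv : m.v = 0) (hj : m.j = 0)
    (hpow : m.pow = fun _ => 0) (hval : m.bestVal = 0) (hcode : m.bestCode = 0) :
    ∃ s' : State, Runs (K + 100) B (prog K) (m.st I num den) s'
        (60 * ((I.n + 1) ^ 2 * (I.scaledBound K num den + 1))) ∧
      ∀ i < I.n, s'.arr 3 i = binaryDigit (I.result K num den I.n).2 i := by
  have hb : Vars.Bounded B {m with
      bound := I.scaledBound K num den
      pow := (fun i => if i ≤ I.n then 2 ^ i else 0) } :=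
    { hm with
      bound := (Nat.le_succ _).trans hI.scaled
      pow := fun i => by
        change (if i ≤ I.n then 2 ^ i else 0) ≤ 2 ^ B
        split_ifs with h
        · exact hI.pow h
        · exact Nat.zero_le _ }
  have h1 := initProg_runs hB hI hm hi hpow
  obtain ⟨m', h2, hm', hi', hpow', hcode'⟩ :=
    mainLoop_runs hB hI hb hi hv hj rfl (fun k hk => if_pos hk) hval hcode
  have h3 := outputProg_runs hB hI hm' hi' (fun k hk => by rw [hpow']; exact if_pos hk)
  refine ⟨_, (h1.seq (h2.seq h3)).mono ?_, fun i hi => ?_⟩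
  · nlinarith [Nat.zero_le (I.n * I.scaledBound K num den), Nat.zero_le (I.n ^ 2)]
  · rw [← hcode']
    exact if_pos hi

end KnapsackProgram

/-! ### Eligible items -/

namespace PKP

variable (I : PKP)

theorem profitAt_coe (i : Fin I.n) : I.profitAt i = I.p i := dif_pos i.2

theorem weightAt_coe (i : Fin I.n) : I.weightAt i = I.w i := dif_pos i.2

theorem penAt_coe (i : Fin I.n) : I.penAt i = I.pen i := dif_pos i.2

/-- Indices differ by less than `n`, so comparing `pen j * n + i` with `pen i * n + j` compares the
penalties first and breaks ties by the index. The second factor tests the weight. -/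
theorem eligible_ne_zero_iff (j i : Fin I.n) :
    I.eligible j i ≠ 0 ↔ i ∈ I.rest j ∧ I.w i ≤ I.c - I.w j := by
  have hi := i.2
  have hj := j.2
  rw [eligible, I.penAt_coe, I.penAt_coe, I.weightAt_coe, I.weightAt_coe, mul_ne_zero_iff]
  refine and_congr ?_ (by omega)
  simp only [rest, Finset.mem_filter, Finset.mem_univ, true_and, Fin.lt_def]
  rcases lt_trichotomy (I.pen i) (I.pen j) with h | h | h
  · have : (I.pen i + 1) * I.n ≤ I.pen j * I.n := Nat.mul_le_mul_right _ h
    rw [add_mul] at this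
    simp only [h, true_or, iff_true]
    omega
  · rw [h]
    simp only [lt_irrefl, true_and, false_or]
    omega
  · have : (I.pen j + 1) * I.n ≤ I.pen i * I.n := Nat.mul_le_mul_right _ h
    rw [add_mul] at this
    simp only [h.not_gt, h.ne', false_and, or_self, iff_false]
    omega

theorem profitAt_le_maxProfit {j i k : ℕ} (hik : i < k) (hi : I.eligible j i ≠ 0) :
    I.profitAt i ≤ I.maxProfit j k := by
  induction k with
  | zero => omega
  | succ k ih =>
    rw [maxProfit]
    rcases Nat.lt_succ_iff_lt_or_eq.1 hik with h | rfl
    · have := ih h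
      split_ifs <;> omega
    · rw [if_neg hi]
      omega

/-- An eligible item is by itself a feasible solution of the remaining knapsack problem. Hence the
scaling unit is controlled by the knapsack optimum. -/
theorem maxProfit_attained (j k : ℕ) :
    I.maxProfit j k = 0 ∨ ∃ i < k, I.eligible j i ≠ 0 ∧ I.profitAt i = I.maxProfit j k := by
  induction k with
  | zero => exact Or.inl rfl
  | succ k ih =>
    rw [maxProfit]
    by_cases h : I.eligible j k = 0
    · rw [if_pos h]
      exact ih.imp_right fun ⟨i, h1, h2⟩ => ⟨i, by omega, h2⟩
    · rw [if_neg h]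
      rcases le_total (I.profitAt k) (I.maxProfit j k) with h1 | h1
      · rw [Nat.sub_eq_zero_of_le h1, add_zero]
        exact ih.imp_right fun ⟨i, h1, h2⟩ => ⟨i, by omega, h2⟩
      · exact Or.inr ⟨k, by omega, h, by omega⟩

/-! ### Codes -/

/-- The code of a set of items: its weight, followed by its characteristic vector. -/
def code (T : Finset (Fin I.n)) : ℕ := ∑ i ∈ T, I.itemCode i

theorem code_eq (T : Finset (Fin I.n)) :
    I.code T = 2 ^ I.n * I.weight T + ∑ i ∈ T, 2 ^ (i : ℕ) := by
  simp only [code, itemCode, weight, Finset.sum_add_distrib, Finset.sum_mul, I.weightAt_coe,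
    mul_comm (2 ^ I.n)]

theorem sum_two_pow_eq {n : ℕ} (T : Finset (Fin n)) :
    ∑ i ∈ T, 2 ^ (i : ℕ) = ∑ i ∈ T.map Fin.valEmbedding, 2 ^ i := by
  simp

theorem sum_two_pow_lt {n : ℕ} (T : Finset (Fin n)) : ∑ i ∈ T, 2 ^ (i : ℕ) < 2 ^ n := by
  rw [sum_two_pow_eq]
  refine Nat.geomSum_lt le_rfl fun k hk => ?_
  obtain ⟨i, -, rfl⟩ := Finset.mem_map.1 hk
  exact i.2

/-- The characteristic vector contributes less than `2 ^ n` and never carries into the weight, so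
comparing a code with a multiple of `2 ^ n` compares weights only. -/
theorem code_lt_codeBound_iff (j : Fin I.n) (T : Finset (Fin I.n)) :
    I.code T < I.codeBound j ↔ I.weight T ≤ I.c - I.w j := by
  have h := sum_two_pow_lt T
  rw [code_eq, codeBound, I.weightAt_coe, mul_comm (_ + 1)]
  constructor
  · intro h1
    by_contra! h2
    have : 2 ^ I.n * (I.c - I.w j + 1) ≤ 2 ^ I.n * I.weight T := Nat.mul_le_mul_left _ h2
    omega
  · intro h1
    have : 2 ^ I.n * I.weight T ≤ 2 ^ I.n * (I.c - I.w j) := Nat.mul_le_mul_left _ h1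
    rw [mul_add, mul_one]
    omega

theorem binaryDigit_eq (x i : ℕ) : binaryDigit x i = (x.testBit i).toNat := by
  rw [Nat.toNat_testBit, binaryDigit]
  omega

theorem binaryDigit_mul_add_sum (a : ℕ) {n : ℕ} (T : Finset (Fin n)) (i : Fin n) :
    binaryDigit (2 ^ n * a + ∑ i ∈ T, 2 ^ (i : ℕ)) i = if i ∈ T then 1 else 0 := by
  rw [binaryDigit_eq, Nat.testBit_two_pow_mul_add _ (sum_two_pow_lt T), if_pos i.2]
  have h : (∑ i ∈ T, 2 ^ (i : ℕ)).testBit i = true ↔ i ∈ T := by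
    rw [← Nat.mem_bitIndices, sum_two_pow_eq, ← List.mem_toFinset,
      Finset.toFinset_bitIndices_sum_two_pow]
    exact Finset.mem_map' Fin.valEmbedding
  by_cases hi : i ∈ T
  · rw [if_pos hi, h.2 hi]
    rfl
  · rw [if_neg hi, Bool.eq_false_iff.2 fun h' => hi (h.1 h')]
    rfl

theorem binaryDigit_code (T : Finset (Fin I.n)) (i : Fin I.n) :
    binaryDigit (I.code T) i = if i ∈ T then 1 else 0 := by
  rw [code_eq, binaryDigit_mul_add_sum]

/-- Only the last `n` digits are updated. The leading part remains the weight of `T`, so the sum is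
not the code of `insert j T`, but the output uses only the digits below `n`. -/
theorem binaryDigit_code_add {T : Finset (Fin I.n)} {j : Fin I.n} (hj : j ∉ T) (i : Fin I.n) :
    binaryDigit (I.code T + 2 ^ (j : ℕ)) i = if i ∈ insert j T then 1 else 0 := by
  rw [← binaryDigit_mul_add_sum (I.weight T), Finset.sum_insert hj, code_eq]
  congr 1
  ring

theorem codeProfit_eq_sum (x k : ℕ) :
    I.codeProfit x k = ∑ i ∈ Finset.range k, I.profitAt i * binaryDigit x i := by
  induction k with
  | zero => rfl
  | succ k ih => rw [codeProfit, ih, Finset.sum_range_succ]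

theorem codeProfit_code (T : Finset (Fin I.n)) : I.codeProfit (I.code T) I.n = I.profit T := by
  rw [codeProfit_eq_sum, Finset.sum_range]
  simp only [binaryDigit_code, profitAt_coe, mul_ite, mul_one, mul_zero, profit]
  rw [Finset.sum_ite_mem, Finset.univ_inter]

/-! ### The dynamic program -/

variable {K num den : ℕ}

/-- Every entry of the table below the bound is the code of a suitable set. -/
theorem exists_code_eq_table {j k v : ℕ} (hk : k ≤ I.n)
    (h : I.table K num den j k v < I.codeBound j) :
    ∃ T : Finset (Fin I.n), (∀ i ∈ T, (i : ℕ) < k ∧ I.eligible j i ≠ 0) ∧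
      I.code T = I.table K num den j k v ∧ v ≤ ∑ i ∈ T, I.scaled K num den j i := by
  induction k generalizing v with
  | zero =>
    rw [table] at h ⊢
    split_ifs at h ⊢ with h0
    · exact ⟨∅, by simp, by simp [code], by simp [h0]⟩
    · exact absurd h (lt_irrefl _)
  | succ k ih =>
    have step : ∀ v, I.table K num den j k v < I.codeBound j → ∃ T : Finset (Fin I.n),
        (∀ i ∈ T, (i : ℕ) < k + 1 ∧ I.eligible j i ≠ 0) ∧
        I.code T = I.table K num den j k v ∧ v ≤ ∑ i ∈ T, I.scaled K num den j i := by
      intro v hv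
      obtain ⟨T, h1, h2⟩ := ih (by omega) hv
      exact ⟨T, fun i hi => ⟨(h1 i hi).1.trans (Nat.lt_succ_self k), (h1 i hi).2⟩, h2⟩
    rw [table] at h ⊢
    by_cases he : I.eligible j k = 0
    · rw [if_pos he] at h ⊢
      exact step v h
    · rw [if_neg he] at h ⊢
      rcases min_choice (I.table K num den j k v)
        (I.table K num den j k (v - I.scaled K num den j k) + I.itemCode k) with h1 | h1
      · rw [h1] at h ⊢
        exact step v h
      · rw [h1] at h ⊢
        obtain ⟨T, h2, h3, h4⟩ := ih (by omega) ((Nat.le_add_right _ _).trans_lt h)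
        have hkT : (⟨k, hk⟩ : Fin I.n) ∉ T := fun h' => lt_irrefl _ (h2 _ h').1
        refine ⟨insert ⟨k, hk⟩ T, fun i hi => ?_, ?_, ?_⟩
        · rcases Finset.mem_insert.1 hi with rfl | hi
          · exact ⟨Nat.lt_succ_self k, he⟩
          · exact ⟨(h2 i hi).1.trans (Nat.lt_succ_self k), (h2 i hi).2⟩
        · rw [code, Finset.sum_insert hkT, ← h3, add_comm]
          rfl
        · rw [Finset.sum_insert hkT]
          dsimp only
          -- The subtraction in `v - scaled` may be truncated, which is harmless because the
          -- requirement is only a scaled profit of at least `v`.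
          omega

/-- The entries of the table are at most the codes of the suitable sets. -/
theorem table_le_code {j k v : ℕ} (T : Finset (Fin I.n))
    (hT : ∀ i ∈ T, (i : ℕ) < k ∧ I.eligible j i ≠ 0)
    (hv : v ≤ ∑ i ∈ T, I.scaled K num den j i) : I.table K num den j k v ≤ I.code T := by
  induction k generalizing v T with
  | zero =>
    obtain rfl : T = ∅ := Finset.eq_empty_of_forall_notMem fun i hi =>
      absurd (hT i hi).1 (Nat.not_lt_zero _)
    obtain rfl : v = 0 := by simpa using hv
    simp [table]
  | succ k ih =>
    rw [table]
    -- If `T` contains item `k`, the second term of the minimum is compared with `T` without that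
    -- item; otherwise `T` was already available in the previous row.
    by_cases hkT : ∃ a ∈ T, (a : ℕ) = k
    · obtain ⟨a, ha, rfl⟩ := hkT
      rw [if_neg (hT a ha).2]
      refine (min_le_right _ _).trans ?_
      have h1 : I.table K num den j a (v - I.scaled K num den j a) ≤ I.code (T.erase a) := by
        refine ih (T.erase a) (fun i hi => ?_) ?_
        · obtain ⟨hne, hi⟩ := Finset.mem_erase.1 hi
          have := Fin.val_ne_of_ne hne
          have h := hT i hi
          exact ⟨by omega, h.2⟩
        · have := Finset.sum_erase_add T (fun i : Fin I.n => I.scaled K num den j i) ha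
          omega
      have h2 := Finset.sum_erase_add T (fun i : Fin I.n => I.itemCode i) ha
      unfold code at h1 ⊢
      omega
    · push Not at hkT
      have h1 : I.table K num den j k v ≤ I.code T := by
        refine ih T (fun i hi => ?_) hv
        have h := hT i hi
        have := hkT i hi
        exact ⟨by omega, h.2⟩
      split_ifs
      · exact h1
      · exact (min_le_left _ _).trans h1

/-- An upward scan retains the last achievable profit. It always finds one, since the empty set
achieves `0` with code `0 < codeBound`; hence `0 < k`. -/
theorem best_spec {j : ℕ} {k : ℕ} (hk : 0 < k) :
    ∃ v, I.table K num den j I.n v < I.codeBound j ∧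
      I.best K num den j k = I.table K num den j I.n v ∧
      ∀ v' < k, I.table K num den j I.n v' < I.codeBound j → v' ≤ v := by
  induction k with
  | zero => omega
  | succ k ih =>
    rw [best]
    by_cases h : I.codeBound j - I.table K num den j I.n k = 0
    · rw [if_pos h]
      rcases Nat.eq_zero_or_pos k with rfl | hk'
      · have h1 := I.table_le_code (K := K) (num := num) (den := den) (j := j) (k := I.n) (v := 0)
          ∅ (by simp) (by simp)
        have h2 : 0 < I.codeBound j := by unfold codeBound; positivity
        simp only [code, Finset.sum_empty] at h1
        omega
      · obtain ⟨v, h1, h2, h3⟩ := ih hk'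
        refine ⟨v, h1, h2, fun v' hv' h4 => ?_⟩
        rcases Nat.lt_succ_iff_lt_or_eq.1 hv' with h5 | rfl
        · exact h3 v' h5 h4
        · omega
    · rw [if_neg h]
      exact ⟨k, by omega, rfl, fun v' hv' _ => by omega⟩

theorem scaled_mul_le (j i : ℕ) :
    I.scaled K num den j i * (I.maxProfit j I.n * num) ≤ I.profitAt i * (K * I.n * den) :=
  Nat.div_mul_le_self _ _

/-- Rounding down loses at most one unit. If the largest eligible profit is `0`, then the profit of
`i` is `0` too and both sides vanish. -/
theorem le_scaled_add_one_mul {j : Fin I.n} {i : Fin I.n} (hi : I.eligible j i ≠ 0)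
    (hnum : 0 < num) :
    I.profitAt i * (K * I.n * den) ≤
      (I.scaled K num den j i + 1) * (I.maxProfit j I.n * num) := by
  have h1 := I.profitAt_le_maxProfit i.2 hi
  rcases Nat.eq_zero_or_pos (I.maxProfit j I.n) with h | h
  · rw [h, Nat.le_zero] at h1
    simp [h1]
  · rw [mul_comm (_ + 1)]
    exact (Nat.lt_mul_div_succ _ (Nat.mul_pos h hnum)).le

/-- Bounding the profit by `maxProfit` cancels the profits altogether. The length of the table thus
depends only on `K`, `n` and `ε`. -/
theorem scaled_le {j : Fin I.n} {i : Fin I.n} (hi : I.eligible j i ≠ 0) :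
    I.scaled K num den j i ≤ K * I.n * den / num := by
  have h1 := I.profitAt_le_maxProfit i.2 hi
  rw [scaled, ← Nat.div_div_eq_div_mul]
  exact Nat.div_le_div_right (Nat.div_le_of_le_mul (Nat.mul_le_mul_right _ h1))

/-- The set that is found for the leading item `j` is nearly optimal. -/
theorem exists_isKPApprox (hK : 0 < K) (hnum : 0 < num) (hden : 0 < den) {δ : ℝ}
    (hδ : (num : ℝ) / (K * den) ≤ δ) (j : Fin I.n) :
    ∃ T : Finset (Fin I.n), I.code T = I.best K num den j (I.scaledBound K num den + 1) ∧
      I.IsKPApprox (I.rest j) (I.c - I.w j) δ T := by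
  obtain ⟨v, hv, hbest, hmax⟩ := I.best_spec (K := K) (num := num) (den := den) (j := j)
    (k := I.scaledBound K num den + 1) (Nat.succ_pos _)
  obtain ⟨T, hT, hcode, hvT⟩ := I.exists_code_eq_table le_rfl hv
  refine ⟨T, hcode.trans hbest.symm, fun i hi => ((I.eligible_ne_zero_iff j i).1 (hT i hi).2).1,
    (I.code_lt_codeBound_iff j T).1 (hcode ▸ hv), ?_⟩
  obtain ⟨O, hO, hOpt⟩ := Finset.exists_mem_eq_sup
    ((I.rest j).powerset.filter fun T => I.weight T ≤ I.c - I.w j)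
    ⟨∅, Finset.mem_filter.2 ⟨Finset.empty_mem_powerset _, Nat.zero_le _⟩⟩ I.profit
  rw [Finset.mem_filter, Finset.mem_powerset] at hO
  have hOe : ∀ i ∈ O, I.eligible j i ≠ 0 := fun i hi =>
    (I.eligible_ne_zero_iff j i).2 ⟨hO.1 hi,
      (Finset.single_le_sum (f := I.w) (fun _ _ => Nat.zero_le _) hi).trans hO.2⟩
  have hcard : O.card ≤ I.n := by simpa using Finset.card_le_univ O
  set qO := ∑ i ∈ O, I.scaled K num den j i with hqO
  set qT := ∑ i ∈ T, I.scaled K num den j i with hqT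
  have hqOb : qO ≤ I.scaledBound K num den := by
    calc qO ≤ O.card • (K * I.n * den / num) :=
          Finset.sum_le_card_nsmul _ _ _ fun i hi => I.scaled_le (hOe i hi)
      _ ≤ I.scaledBound K num den := Nat.mul_le_mul_right _ hcard
  -- The scaled profit of the optimum `O` lies within the table and its entry is achievable, so the
  -- maximality of `v` applies.
  have hq : qO ≤ qT := by
    refine (hmax qO (Nat.lt_succ_of_le hqOb) ?_).trans hvT
    exact (I.table_le_code O (fun i hi => ⟨i.2, hOe i hi⟩) le_rfl).trans_lt
      ((I.code_lt_codeBound_iff j O).2 hO.2)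
  have hmaxO : I.maxProfit j I.n ≤ I.profit O := by
    rcases I.maxProfit_attained j I.n with h | ⟨i, hi, he, h⟩
    · rw [h]
      exact Nat.zero_le _
    · have he' := (I.eligible_ne_zero_iff j ⟨i, hi⟩).1 he
      rw [← hOpt, ← h, show I.profitAt i = I.profit {⟨i, hi⟩} by
        simp [profit, ← profitAt_coe]]
      refine Finset.le_sup (f := I.profit) ?_
      rw [Finset.mem_filter, Finset.mem_powerset, Finset.singleton_subset_iff]
      exact ⟨he'.1, by simpa [weight] using he'.2⟩
  have h1 : qT * (I.maxProfit j I.n * num) ≤ I.profit T * (K * I.n * den) := by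
    simp only [hqT, profit, Finset.sum_mul, ← profitAt_coe]
    exact Finset.sum_le_sum fun i _ => I.scaled_mul_le j i
  have h2 : I.profit O * (K * I.n * den) ≤ (qO + I.n) * (I.maxProfit j I.n * num) := by
    calc I.profit O * (K * I.n * den)
        ≤ ∑ i ∈ O, (I.scaled K num den j i + 1) * (I.maxProfit j I.n * num) := by
          simp only [profit, Finset.sum_mul, ← profitAt_coe]
          exact Finset.sum_le_sum fun i hi => I.le_scaled_add_one_mul (hOe i hi) hnum
      _ = (qO + O.card) * (I.maxProfit j I.n * num) := by
          rw [← Finset.sum_mul, Finset.sum_add_distrib, Finset.sum_const, smul_eq_mul, mul_one]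
      _ ≤ _ := by gcongr
  have hn : 0 < I.n := j.pos
  -- Up to `n` units are lost, each worth `maxProfit * num / (K * n * den)`. With `maxProfit ≤
  -- profit O`, the factor `n` cancels and the relative loss is `num / (K * den)`.
  have h3 : I.profit O * (K * den) ≤ I.profit T * (K * den) + I.profit O * num := by
    refine Nat.le_of_mul_le_mul_left ?_ hn
    have h4 : qO * (I.maxProfit j I.n * num) ≤ qT * (I.maxProfit j I.n * num) := by gcongr
    have h5 : I.n * (I.maxProfit j I.n * num) ≤ I.n * (I.profit O * num) := by gcongr
    rw [add_mul] at h2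
    linarith
  rw [kpOpt, hOpt]
  have hKd : (0 : ℝ) < K * den := by positivity
  have h4 : (I.profit O : ℝ) * (K * den) ≤ I.profit T * (K * den) + I.profit O * num := by
    exact_mod_cast h3
  have h5 : (I.profit O : ℝ) ≤ I.profit T + I.profit O * (num / (K * den)) := by
    rw [← mul_div_assoc, ← sub_le_iff_le_add', le_div_iff₀ hKd]
    linarith
  have h6 := mul_le_mul_of_nonneg_left hδ (Nat.cast_nonneg (α := ℝ) (I.profit O))
  linarith

theorem notMem_rest (j : Fin I.n) : j ∉ I.rest j := by
  simp [rest]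

/-- The leading item fixes the penalty, because later items never have a larger one. This is what
reduces the choice of `T` to an ordinary knapsack problem. -/
theorem sup_pen_insert {j : Fin I.n} {T : Finset (Fin I.n)} (hT : T ⊆ I.rest j) :
    (insert j T).sup I.pen = I.pen j := by
  rw [Finset.sup_insert, sup_eq_left]
  refine Finset.sup_le fun i hi => ?_
  have := hT hi
  simp only [rest, Finset.mem_filter, Finset.mem_univ, true_and] at this
  omega

theorem value_insert {j : Fin I.n} {T : Finset (Fin I.n)} (hT : T ⊆ I.rest j) :
    I.value (insert j T) = (I.p j : ℤ) + I.profit T - I.pen j := by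
  rw [value, I.sup_pen_insert hT, profit, Finset.sum_insert fun h => I.notMem_rest j (hT h)]
  push_cast [profit]
  rfl

theorem value_empty : I.value ∅ = 0 := by
  simp [value, profit]

/-- The result of the program is a best candidate among the leading items `j < k`. -/
theorem result_spec (T : Fin I.n → Finset (Fin I.n))
    (hcode : ∀ j, I.code (T j) = I.best K num den j (I.scaledBound K num den + 1))
    (hT : ∀ j, T j ⊆ I.rest j) {k : ℕ} (hk : k ≤ I.n) :
    ∃ S ∈ I.candidates T, I.value S = (I.result K num den k).1 ∧
      (∀ i : Fin I.n, binaryDigit (I.result K num den k).2 i = if i ∈ S then 1 else 0) ∧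
      ∀ j : Fin I.n, (j : ℕ) < k → I.w j ≤ I.c →
        I.value (insert j (T j)) ≤ (I.result K num den k).1 := by
  induction k with
  | zero =>
    refine ⟨∅, Finset.mem_insert_self _ _, I.value_empty, fun i => ?_, fun j hj => ?_⟩
    · simp [result, binaryDigit]
    · omega
  | succ k ih =>
    obtain ⟨S, h1, h2, h3, h4⟩ := ih (by omega)
    set j₀ : Fin I.n := ⟨k, hk⟩ with hj₀
    have hw : I.weightAt k = I.w j₀ := I.weightAt_coe j₀
    have hp : I.profitAt k = I.p j₀ := I.profitAt_coe j₀
    have hpen : I.penAt k = I.pen j₀ := I.penAt_coe j₀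
    have hval := I.value_insert (hT j₀)
    have hlt : ∀ j : Fin I.n, (j : ℕ) < k + 1 → j = j₀ ∨ (j : ℕ) < k := fun j hj => by
      rw [Fin.ext_iff]
      exact (Nat.lt_succ_iff_lt_or_eq.1 hj).symm
    have hx : I.best K num den k (I.scaledBound K num den + 1) = I.code (T j₀) := (hcode j₀).symm
    rw [result]
    simp only [hw, hp, hpen, hx, I.codeProfit_code]
    split_ifs with hc hv
    · refine ⟨S, h1, h2, h3, fun j hj hjc => ?_⟩
      rcases hlt j hj with rfl | hj
      · omega
      · exact h4 j hj hjc
    · refine ⟨S, h1, h2, h3, fun j hj hjc => ?_⟩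
      rcases hlt j hj with rfl | hj
      · rw [hval]
        omega
      · exact h4 j hj hjc
    -- In this branch the profit strictly exceeds the penalty plus the previous best value, so the
    -- natural subtraction is exact.
    · have hnew : I.value (insert j₀ (T j₀)) =
          ((I.p j₀ + I.profit (T j₀) - I.pen j₀ : ℕ) : ℤ) := by
        rw [hval]
        omega
      refine ⟨insert j₀ (T j₀), ?_, hnew, ?_, fun j hj hjc => ?_⟩
      · refine Finset.mem_insert_of_mem (Finset.mem_image_of_mem _ ?_)
        exact Finset.mem_filter.2 ⟨Finset.mem_univ _, by omega⟩
      · exact I.binaryDigit_code_add fun h => I.notMem_rest j₀ (hT j₀ h)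
      · rcases hlt j hj with rfl | hj
        · exact hnew.le
        · refine (h4 j hj hjc).trans ?_
          omega

/-- The result of the program is an output of `A(δ)`. -/
theorem exists_isOutputA (hK : 0 < K) (hnum : 0 < num) (hden : 0 < den) {δ : ℝ}
    (hδ : (num : ℝ) / (K * den) ≤ δ) :
    ∃ S : Finset (Fin I.n), I.IsOutputA δ S ∧
      ∀ i : Fin I.n, binaryDigit (I.result K num den I.n).2 i = if i ∈ S then 1 else 0 := by
  choose T hcode hT using I.exists_isKPApprox hK hnum hden hδ
  obtain ⟨S, h1, h2, h3, h4⟩ := I.result_spec T hcode (fun j => (hT j).1) le_rfl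
  refine ⟨S, ⟨T, fun j _ => hT j, h1, fun S' hS' => ?_⟩, h3⟩
  rw [h2]
  rcases Finset.mem_insert.1 hS' with rfl | hS'
  · rw [I.value_empty]
    exact Int.natCast_nonneg _
  · obtain ⟨j, hj, rfl⟩ := Finset.mem_image.1 hS'
    exact h4 j j.2 (Finset.mem_filter.1 hj).2

/-! ### The approximation guarantee -/

theorem opt_nonneg : 0 ≤ I.opt := by
  rw [← I.value_empty]
  exact Finset.le_sup' I.value (Finset.mem_filter.2 ⟨Finset.mem_univ _, by simp [Feasible, weight]⟩)

theorem pMin_le (j : Fin I.n) : I.pMin ≤ I.p j :=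
  ciInf_le (OrderBot.bddBelow _) j

/-- The first item of a non-empty set in the order of the algorithm. -/
theorem exists_erase_subset_rest {S : Finset (Fin I.n)} (hS : S.Nonempty) :
    ∃ j ∈ S, S.erase j ⊆ I.rest j := by
  obtain ⟨m, hm, hmax⟩ := S.exists_max_image I.pen hS
  obtain ⟨j, hj, hmin⟩ := (S.filter fun i => I.pen i = I.pen m).exists_min_image id
    ⟨m, Finset.mem_filter.2 ⟨hm, rfl⟩⟩
  rw [Finset.mem_filter] at hj
  refine ⟨j, hj.1, fun i hi => ?_⟩
  rw [Finset.mem_erase] at hi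
  simp only [rest, Finset.mem_filter, Finset.mem_univ, true_and]
  rcases (hmax i hi.2).lt_or_eq with h | h
  · exact Or.inl (h.trans_eq hj.2.symm)
  · exact Or.inr ⟨h.trans hj.2.symm,
      lt_of_le_of_ne (hmin i (Finset.mem_filter.2 ⟨hi.2, h⟩)) hi.1.symm⟩

theorem IsOutputA.feasible {δ : ℝ} {S : Finset (Fin I.n)} (h : I.IsOutputA δ S) :
    I.Feasible S := by
  obtain ⟨T, hT, hS, -⟩ := h
  rcases Finset.mem_insert.1 hS with rfl | hS
  · simp [Feasible, weight]
  · obtain ⟨j, hj, rfl⟩ := Finset.mem_image.1 hS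
    have hjc := (Finset.mem_filter.1 hj).2
    obtain ⟨h1, h2, -⟩ := hT j hjc
    rw [Feasible, weight, Finset.sum_insert fun h => I.notMem_rest j (h1 h)]
    unfold weight at h2
    omega

/-- The output is compared with the candidate led by the first item of an optimal set. Its loss is
`δ` times the profit of the other optimal items, which `key` bounds by a multiple of `z*`. -/
theorem IsOutputA.isApprox {ρ : ℝ} (hρ : 1 / 2 < ρ) (hρ' : ρ < 1)
    (hI : ρ * (I.penMax : ℝ) ≤ (I.pMin : ℝ)) {ε : ℝ} (hε : 0 < ε) (hε' : ε < 1)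
    {S : Finset (Fin I.n)} (h : I.IsOutputA (ε * (2 * ρ - 1) / ρ) S) : I.IsApprox ε S := by
  refine ⟨h.feasible, ?_⟩
  obtain ⟨T, hT, hS, hmax⟩ := h
  obtain ⟨O, hO, hOpt⟩ := Finset.exists_mem_eq_sup' I.feasible_nonempty I.value
  change I.opt = I.value O at hOpt
  have hfeas : I.weight O ≤ I.c := (Finset.mem_filter.1 hO).2
  have hnonneg := I.opt_nonneg
  rcases O.eq_empty_or_nonempty with rfl | hne
  · rw [hOpt, I.value_empty]
    have h1 := hmax ∅ (Finset.mem_insert_self _ _)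
    rw [I.value_empty] at h1
    simpa using h1
  obtain ⟨j, hj, hrest⟩ := I.exists_erase_subset_rest hne
  have hw : I.weight (O.erase j) + I.w j = I.weight O := Finset.sum_erase_add O I.w hj
  have hjc : I.w j ≤ I.c := by omega
  obtain ⟨h1, -, h3⟩ := hT j hjc
  have h4 := hmax _ (Finset.mem_insert_of_mem
    (Finset.mem_image_of_mem _ (Finset.mem_filter.2 ⟨Finset.mem_univ _, hjc⟩)))
  have h5 : I.profit (O.erase j) ≤ I.kpOpt (I.rest j) (I.c - I.w j) := by
    refine Finset.le_sup (f := I.profit) ?_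
    rw [Finset.mem_filter, Finset.mem_powerset]
    exact ⟨hrest, by omega⟩
  have hval : I.value O = (I.p j : ℤ) + I.profit (O.erase j) - I.pen j := by
    rw [← I.value_insert hrest, Finset.insert_erase hj]
  rw [I.value_insert h1] at h4
  set Q := I.profit (O.erase j) with hQ
  have hz : (I.opt : ℝ) = I.p j + Q - I.pen j := by
    rw [hOpt, hval]
    push_cast
    rfl
  have hz0 : (0 : ℝ) ≤ I.opt := by exact_mod_cast hnonneg
  have h4' : (I.p j : ℝ) + I.profit (T j) - I.pen j ≤ I.value S := by exact_mod_cast h4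
  have h5' : (Q : ℝ) ≤ I.kpOpt (I.rest j) (I.c - I.w j) := by exact_mod_cast h5
  have hρ0 : 0 < ρ := by linarith
  have hδ : ε * (2 * ρ - 1) / ρ ≤ 1 := by
    rw [div_le_one hρ0]
    nlinarith
  have h6 : (1 - ε * (2 * ρ - 1) / ρ) * Q ≤ I.profit (T j) :=
    (mul_le_mul_of_nonneg_left h5' (by linarith)).trans h3
  have key : (2 * ρ - 1) / ρ * Q ≤ I.opt := by
    rcases (O.erase j).eq_empty_or_nonempty with he | ⟨i, hi⟩
    · have : Q = 0 := by rw [hQ, he]; rfl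
      simpa [this] using hz0
    · have hQp : I.pMin ≤ Q :=
        (I.pMin_le i).trans (Finset.single_le_sum (f := I.p) (fun _ _ => Nat.zero_le _) hi)
      have hpj := I.pMin_le j
      have hpen : I.pen j ≤ I.penMax := Finset.le_sup (Finset.mem_univ j)
      have a1 : (I.pMin : ℝ) ≤ Q := by exact_mod_cast hQp
      have a2 : (I.pMin : ℝ) ≤ I.p j := by exact_mod_cast hpj
      have a3 : (I.pen j : ℝ) ≤ I.penMax := by exact_mod_cast hpen
      rw [hz, div_mul_eq_mul_div, div_le_iff₀ hρ0]
      -- Weighting `p j ≥ pMin` by `ρ` and `Q ≥ pMin` by `1 - ρ` gives a convex combination that is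
      -- at least `pMin ≥ ρ * penMax`.
      nlinarith
  have h7 := mul_le_mul_of_nonneg_left key hε.le
  have e : ε * ((2 * ρ - 1) / ρ * Q) = ε * (2 * ρ - 1) / ρ * Q := by ring
  linarith

end PKP

/-! ### Polynomial cost bound -/

namespace PKP

variable (I : PKP)

/-- The one charged for each number on top of its digits bounds `n` linearly by the encoding length,
even if all the data are `0`. -/
theorem three_mul_n_add_two_le_size : 3 * I.n + 2 ≤ I.size := by
  have h : ∑ _j : Fin I.n, 3 ≤
      ∑ j, ((Nat.size (I.w j) + 1) + (Nat.size (I.p j) + 1) + (Nat.size (I.pen j) + 1)) :=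
    Finset.sum_le_sum fun j _ => by omega
  simp only [Finset.sum_const, Finset.card_univ, Fintype.card_fin, smul_eq_mul] at h
  unfold size
  omega

theorem size_item_le (j : Fin I.n) :
    Nat.size (I.w j) + Nat.size (I.p j) + Nat.size (I.pen j) ≤ I.size := by
  have h := Finset.single_le_sum (f := fun j : Fin I.n =>
    (Nat.size (I.w j) + 1) + (Nat.size (I.p j) + 1) + (Nat.size (I.pen j) + 1))
    (fun _ _ => Nat.zero_le _) (Finset.mem_univ j)
  unfold size
  omega

theorem codeProfit_le {M : ℕ} (h : ∀ i, I.profitAt i ≤ M) (x k : ℕ) :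
    I.codeProfit x k ≤ k * M := by
  rw [codeProfit_eq_sum]
  refine (Finset.sum_le_card_nsmul _ _ M fun i _ => ?_).trans_eq (by simp)
  have h1 : binaryDigit x i ≤ 1 := by
    rw [binaryDigit_eq]
    exact Bool.toNat_le _
  calc I.profitAt i * binaryDigit x i ≤ I.profitAt i * 1 := Nat.mul_le_mul_left _ h1
    _ ≤ M := by simpa using h i

end PKP

namespace KnapsackProgram

variable (I : PKP) (K num den : ℕ)

theorem le_two_pow_of_size_le {x L : ℕ} (h : Nat.size x ≤ L) : x ≤ 2 ^ L :=
  (Nat.size_le.1 h).le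

/-- All the numbers that occur in a run have linearly many binary digits. -/
theorem inputBounded {L : ℕ} (hL : L = I.size + Nat.size num + Nat.size den) :
    InputBounded I K num den (3 * L + K + 1) := by
  have hn := I.three_mul_n_add_two_le_size
  have hLpow : L < 2 ^ L := Nat.lt_two_pow_self
  have hmono : 2 ^ L ≤ 2 ^ (3 * L + K + 1) := Nat.pow_le_pow_right (by norm_num) (by omega)
  have hc : I.c ≤ 2 ^ L := le_two_pow_of_size_le (by unfold PKP.size at hL; omega)
  have hnum : num ≤ 2 ^ L := le_two_pow_of_size_le (by omega)
  have hden : den ≤ 2 ^ L := le_two_pow_of_size_le (by omega)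
  have hitem : ∀ i, I.profitAt i ≤ 2 ^ L ∧ I.weightAt i ≤ 2 ^ L ∧ I.penAt i ≤ 2 ^ L := by
    intro i
    unfold PKP.profitAt PKP.weightAt PKP.penAt
    split_ifs with h
    · have := I.size_item_le ⟨i, h⟩
      exact ⟨le_two_pow_of_size_le (by omega), le_two_pow_of_size_le (by omega),
        le_two_pow_of_size_le (by omega)⟩
    · exact ⟨Nat.zero_le _, Nat.zero_le _, Nat.zero_le _⟩
  refine ⟨by omega, hc.trans hmono, hnum.trans hmono, hden.trans hmono,
    fun i => (hitem i).1.trans hmono, fun i => (hitem i).2.1.trans hmono,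
    fun i => (hitem i).2.2.trans hmono, ?_, ?_, fun i x k hk => ?_⟩
  · calc (I.c + 2) * 2 ^ I.n ≤ (2 ^ L * 2) * 2 ^ L := by
          refine Nat.mul_le_mul (by omega) (Nat.pow_le_pow_right (by norm_num) (by omega))
      _ = 2 ^ (L + 1 + L) := by ring
      _ ≤ 2 ^ (3 * L + K + 1) := Nat.pow_le_pow_right (by norm_num) (by omega)
  · have hK : K ≤ 2 ^ K := Nat.lt_two_pow_self.le
    have hn' : I.n ≤ 2 ^ L := by omega
    -- This determines the exponent `3 * L + K + 1`: the factors `n`, `n` and `den` give `3 * L`,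
    -- the factor `K` gives `K`, and the last `1` makes room for the loop counter one past the
    -- bound.
    have h1 : I.scaledBound K num den ≤ 2 ^ L * (2 ^ K * 2 ^ L * 2 ^ L) :=
      Nat.mul_le_mul hn' ((Nat.div_le_self _ _).trans
        (Nat.mul_le_mul (Nat.mul_le_mul hK hn') hden))
    have h2 : 2 ^ (3 * L + K + 1) = 2 ^ L * (2 ^ K * 2 ^ L * 2 ^ L) * 2 := by ring
    have h3 : 0 < 2 ^ L * (2 ^ K * 2 ^ L * 2 ^ L) := by positivity
    omega
  · calc I.profitAt i + I.codeProfit x k ≤ 2 ^ L + k * 2 ^ L :=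
          Nat.add_le_add (hitem i).1 (I.codeProfit_le (fun i => (hitem i).1) x k)
      _ = (k + 1) * 2 ^ L := by ring
      _ ≤ 2 ^ L * 2 ^ L := Nat.mul_le_mul_right _ (by omega)
      _ = 2 ^ (L + L) := by ring
      _ ≤ 2 ^ (3 * L + K + 1) := Nat.pow_le_pow_right (by norm_num) (by omega)

/-- The initial values of the variables. -/
def initialVars : Vars := ⟨0, 0, 0, 0, 0, 0, 0, 0, 0, fun _ => 0, fun _ => 0, fun _ => 0⟩

theorem initialVars_bounded (B : ℕ) : initialVars.Bounded B := by
  constructor <;> simp [initialVars]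

theorem input_eq (ε : ℚ) : I.input ε = initialVars.st I ε.num.toNat ε.den := by
  simp only [PKP.input, Vars.st, State.mk.injEq]
  constructor
  · funext x
    rcases x with (_|_|_|_|_|_|_|_|_|_|_|_|_|x) <;> simp [initialVars]
  · funext a i
    rcases a with (_|_|_|_|_|_|a) <;>
      simp [initialVars, PKP.profitAt, PKP.weightAt, PKP.penAt]

/-- The cost of the program is polynomial in the encoding length and `1 / ε`. -/
theorem cost_le {ε : ℚ} (hε : 0 < ε) {L : ℕ}
    (hL : L = I.size + Nat.size ε.num.toNat + Nat.size ε.den) :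
    ((60 * ((I.n + 1) ^ 2 * (I.scaledBound K ε.num.toNat ε.den + 1)) *
        unit (K + 100) (3 * L + K + 1) : ℕ) : ℝ) ≤
      (60 * (K + 1) * ((K + 100) * ((K + 4) * (K + 100) + 2) + 1) : ℕ) *
        ((L : ℝ) + 1 / (ε : ℝ)) ^ 6 := by
  have hnumpos : 0 < ε.num := Rat.num_pos.2 hε
  have hnum : ((ε.num.toNat : ℕ) : ℝ) = (ε.num : ℝ) := by
    exact_mod_cast Int.toNat_of_nonneg hnumpos.le
  have hε' : (1 : ℝ) / ε = ε.den / (ε.num.toNat : ℕ) := by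
    rw [hnum, Rat.cast_def, one_div_div]
  have hεpos : (0 : ℝ) < 1 / ε := by
    have : (0 : ℝ) < ε := by exact_mod_cast hε
    positivity
  have hn := I.three_mul_n_add_two_le_size
  set x : ℝ := (L : ℝ) + 1 / (ε : ℝ) with hx
  have hLx : (L : ℝ) ≤ x := by linarith
  have hεx : 1 / (ε : ℝ) ≤ x := by
    have : (0 : ℝ) ≤ L := Nat.cast_nonneg _
    linarith
  have hnL : ((I.n + 1 : ℕ) : ℝ) ≤ L := by exact_mod_cast (by omega : I.n + 1 ≤ L)
  have hn1 : ((I.n + 1 : ℕ) : ℝ) ≤ x := hnL.trans hLx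
  have hn0 : (I.n : ℝ) ≤ x := by push_cast at hn1; linarith
  have hx1 : 1 ≤ x := by
    push_cast at hn1
    have : (0 : ℝ) ≤ I.n := Nat.cast_nonneg _
    linarith
  have hscaled : ((I.scaledBound K ε.num.toNat ε.den + 1 : ℕ) : ℝ) ≤ (K + 1) * x ^ 3 := by
    -- The quotient `den / num` is `1 / ε`; this is where the dependence on `1 / ε` enters the
    -- running time.
    have h1 : ((K * I.n * ε.den / ε.num.toNat : ℕ) : ℝ) ≤ K * I.n * (1 / (ε : ℝ)) := by
      refine Nat.cast_div_le.trans_eq ?_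
      rw [hε']
      push_cast
      ring
    have h2 : (I.n : ℝ) * (K * I.n * (1 / (ε : ℝ))) ≤ x * (K * x * x) := by gcongr
    have h3 : 1 ≤ x ^ 3 := one_le_pow₀ hx1
    have h4 : (I.n : ℝ) * ((K * I.n * ε.den / ε.num.toNat : ℕ) : ℝ) ≤
        I.n * (K * I.n * (1 / (ε : ℝ))) := by gcongr
    unfold PKP.scaledBound
    rw [Nat.cast_add, Nat.cast_mul, Nat.cast_one]
    linarith
  have hunit : (unit (K + 100) (3 * L + K + 1) : ℝ) ≤
      ((K + 100) * ((K + 4) * (K + 100) + 2) + 1) * x := by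
    have hK : (0 : ℝ) ≤ K := Nat.cast_nonneg _
    have hB : (3 * L + K + 1 : ℝ) ≤ (K + 4) * x := by nlinarith
    unfold RAM.unit
    push_cast
    calc ((K : ℝ) + 100) * ((3 * L + K + 1) * (K + 100) + 2) + 1
        ≤ (K + 100) * ((K + 4) * x * (K + 100) + 2 * x) + x := by gcongr; linarith
      _ = _ := by ring
  push_cast at hscaled hunit hn1 ⊢
  -- The degree `6` is `2` for the items and leading items, `3` for the table length (`n * n / ε`),
  -- and `1` for the digits handled in a step.
  calc (60 : ℝ) * ((I.n + 1) ^ 2 * (I.scaledBound K ε.num.toNat ε.den + 1)) *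
        unit (K + 100) (3 * L + K + 1)
      ≤ 60 * (x ^ 2 * ((K + 1) * x ^ 3)) *
        (((K + 100) * ((K + 4) * (K + 100) + 2) + 1) * x) := by gcongr
    _ = _ := by ring

/-- On every input, the program halts with an output of `A(δ)` for every `δ ≥ ε / K`, in
polynomial time. -/
theorem outputs (hK : 0 < K) {ε : ℚ} (hε : 0 < ε) {δ : ℝ} (hδ : (ε : ℝ) / K ≤ δ) :
    ∃ (S : Finset (Fin I.n)) (t : ℕ), PKP.Outputs (prog K) I ε S t ∧ I.IsOutputA δ S ∧
      (t : ℝ) ≤ (60 * (K + 1) * ((K + 100) * ((K + 4) * (K + 100) + 2) + 1) : ℕ) *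
        (((I.size + Nat.size ε.num.toNat + Nat.size ε.den : ℕ) : ℝ) + 1 / (ε : ℝ)) ^ 6 := by
  have hnumpos : 0 < ε.num := Rat.num_pos.2 hε
  have hnum : ((ε.num.toNat : ℕ) : ℝ) = (ε.num : ℝ) := by
    exact_mod_cast Int.toNat_of_nonneg hnumpos.le
  obtain ⟨S, hS, hbits⟩ := I.exists_isOutputA (K := K) (num := ε.num.toNat) (den := ε.den)
    hK (by omega) ε.den_pos (δ := δ) (by
      refine le_trans (le_of_eq ?_) hδ
      rw [hnum, mul_comm, ← div_div, ← Rat.cast_def])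
  obtain ⟨s', ⟨t, hexec, ht⟩, hout⟩ := prog_runs (by omega) (inputBounded I K _ _ rfl)
    (initialVars_bounded _) rfl rfl rfl rfl rfl rfl
  refine ⟨S, t, ⟨s', by rwa [input_eq], fun j => ?_⟩, hS, ?_⟩
  · rw [hout j j.2, hbits]
  · exact (Nat.cast_le.2 ht).trans (cost_le I K hε rfl)

end KnapsackProgram

/-! ### Uniqueness of the output and the theorem -/

/-- The output of a program is determined by the input. -/
theorem PKP.Outputs.unique {P : Prog} {I : PKP} {ε : ℚ} {S S' : Finset (Fin I.n)} {t t' : ℕ}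
    (h : PKP.Outputs P I ε S t) (h' : PKP.Outputs P I ε S' t') : S = S' := by
  obtain ⟨s, hs, hS⟩ := h
  obtain ⟨s', hs', hS'⟩ := h'
  obtain ⟨rfl, -⟩ := hs.det hs'
  ext j
  have h1 := (hS j).symm.trans (hS' j)
  by_cases ha : j ∈ S <;> by_cases hb : j ∈ S' <;> simp_all

theorem mainTheorem11 (ρ : ℝ) (hρ : 1 / 2 < ρ) (hρ' : ρ < 1) :
    (∃ P : RAM.Prog,
      PKP.IsFPTAS P (fun I => ρ * (I.penMax : ℝ) ≤ (I.pMin : ℝ)) ∧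
      ∀ I : PKP, ρ * (I.penMax : ℝ) ≤ (I.pMin : ℝ) → ∀ ε : ℚ, 0 < ε → ε < 1 →
        ∀ (S : Finset (Fin I.n)) (t : ℕ), PKP.Outputs P I ε S t →
          I.IsOutputA ((ε : ℝ) * (2 * ρ - 1) / ρ) S) ∧
    ∀ I : PKP, ρ * (I.penMax : ℝ) ≤ (I.pMin : ℝ) → ∀ ε : ℝ, 0 < ε → ε < 1 →
      ∀ S : Finset (Fin I.n), I.IsOutputA (ε * (2 * ρ - 1) / ρ) S → I.IsApprox ε S := by
  have hρ0 : 0 < ρ := by linarith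
  have hρ1 : 0 < 2 * ρ - 1 := by linarith
  -- Rounding `ρ / (2ρ - 1)` up to a natural number makes the program independent of the real number
  -- `ρ` except through the constant `K`; the precision only improves.
  obtain ⟨K, hK⟩ := exists_nat_gt (ρ / (2 * ρ - 1))
  have hK0 : (0 : ℝ) < K := (div_pos hρ0 hρ1).trans hK
  have hδ : ∀ ε : ℚ, 0 < ε → (ε : ℝ) / K ≤ (ε : ℝ) * (2 * ρ - 1) / ρ := by
    intro ε hε
    have hε' : (0 : ℝ) < ε := by exact_mod_cast hε
    rw [div_lt_iff₀ hρ1] at hK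
    rw [div_le_div_iff₀ hK0 hρ0, mul_assoc]
    exact mul_le_mul_of_nonneg_left (by linarith) hε'.le
  have main := fun (I : PKP) (ε : ℚ) (hε : 0 < ε) =>
    KnapsackProgram.outputs I K (Nat.cast_pos.1 hK0) hε (hδ ε hε)
  refine ⟨⟨KnapsackProgram.prog K, ⟨60 * (K + 1) * ((K + 100) * ((K + 4) * (K + 100) + 2) + 1), 6,
    fun I hI ε hε hε' => ?_⟩,
    fun I _ ε hε _ S t hS => ?_⟩, fun I hI ε hε hε' S hS => hS.isApprox I hρ hρ' hI hε hε'⟩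
  · obtain ⟨S, t, h1, h2, h3⟩ := main I ε hε
    exact ⟨S, t, h1, h2.isApprox I hρ hρ' hI (by exact_mod_cast hε) (by exact_mod_cast hε'), h3⟩
  -- One run that ends with an output of `A(δ)` is known to exist, and by determinism every run
  -- yields the same set.
  · obtain ⟨S', t', h1, h2, -⟩ := main I ε hε
    rwa [hS.unique h1]
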